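/- Let $\alpha_1,\alpha_2,\alpha_3,\beta$ be the $4\times4$ Dirac matrices in the standard representation and $D^0=-i\sum_l\alpha_l\partial_l+\beta$ the free Dirac operator on $\mathbb R^3$ ($c=m=\hbar=1$). Potentials are functions on $\mathbb R^3$ with values in the Hermitian $4\times4$ matrices (for example $A_0+\sum_l\alpha_lA_l$ with real $A_0,\dots,A_3$). For $E\ge1$ and $\kappa=\sqrt{E^2-1}$ let $$G^+_E(\mathbf x)=\frac{e^{i\kappa x}}{4\pi}\Big(-\frac1x\Big(E+\kappa\sum_j\alpha_j\frac{x_j}{x}+\beta\Big)-\frac{i}{x^2}\sum_j\alpha_j\frac{x_j}{x}\Big),\qquad x=|\mathbf x|,$$ be the kernel of $(E-D^0+i0)^{-1}$, and for $V\in L^1\cap L^\infty$ put $(T^V_Ef)(\mathbf x)=\int G^+_E(\mathbf x-\mathbf y)V(\mathbf y)f(\mathbf y)\,d^3y$, $f\in L^\infty(\mathbb R^3;\mathbb C^4)$. Let $\mathcal B\subset L^\infty$ be the space of functions tending uniformly to $0$ at infinity, and write $\langle f,V,g\rangle=\int f^\dagger Vg\,d^3x$, $\mathcal N=\{\Phi\in\mathcal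 B:(1-T^A_1)\Phi=0\}$ and $\mathcal M^\perp=\{m\in\mathcal B:\langle m,A,\Phi\rangle=0\ \forall\Phi\in\mathcal N\}$. On $\mathcal N$ the norm $\|\cdot\|$ is the $L^\infty$ norm. Let $\mathcal C$ be the set of potentials $A$ such that: (a) $A$ is critical, i.e. $\mathcal N\ne\{0\}$, and $A$ is Lipschitz continuous; (b) $(1+|\cdot|)^2A\in L^1\cap L^\infty$; (c) $\mathcal N\cap\mathcal M^\perp=\{0\}$; (d) $\mathcal N\subset L^2$ or $\mathcal N\cap L^2=\{0\}$; (e) for every $0\ne\Phi\in\mathcal N$, $\int A\Phi\,d^3x\ne0$ or $(1-i\beta)\int A(\mathbf x)\Phi(\mathbf x)\,\mathbf x\,d^3x\ne0$. For $K>0$ let $\mathcal W_K$ be the set of potentials $B\in L^1\cap L^\infty$ with $\|\Phi\|_\infty^2(\|B\|_1+\|B\|_\infty)^2\le K\,|\langle\Phi,B,\Phi\rangle|$ for all $\Phi\in\mathcal N$. For $\mathbf k\in\mathbb R^3$ write $k=|\mathbf k|$, $E_k=\sqrt{k^2+1}$, and let $\chi(j,\mathbf k,\mathbf x)=e^{i\mathbf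 k\cdot\mathbf x}s_j(\mathbf k)$, $j=1,2$, be generalized eigenfunctions of $D^0$ with energy $+E_k$, where the $s_j(\mathbf k)$ are arbitrary unit spinors with $(\sum_l\alpha_lk_l+\beta)s_j(\mathbf k)=E_ks_j(\mathbf k)$. **Theorem.** Let $A\in\mathcal C$ and suppose that no nonzero element of $\mathcal N$ is square integrable ($\mathcal N\cap L^2=\{0\}$). Then there exist constants $C,K,k_0>0$ such that for all $\mathbf k\in\mathbb R^3$ with $k<k_0$, $j=1,2$, and all $B\in\mathcal W_K$, with $\mathbf k$ and $B$ not both zero, the Lippmann–Schwinger equation $$(1-T^{A+B}_{E_k})\,\phi(A+B,j,\mathbf k,\cdot)=\chi(j,\mathbf k,\cdot)$$ has exactly one solution $\phi(A+B,j,\mathbf k,\cdot)\in L^\infty$, and there is $\Phi^B_{j,\mathbf k}\in\mathcal N$ with $$\|\Phi^B_{j,\mathbf k}\|\le C\Big(\inf_{\Psi\in\mathcal N,\|\Psi\|=1}|\langle\Psi,B,\Psi\rangle|+k\Big)^{-1}$$ and $$\|\phi(A+B,j,\mathbf k,\cdot)-\Phi^B_{j,\mathbf k}\|_\infty<C\,\big(k+\|B\|_1+\|B\|_\infty\big)\Big(\inf_{\Psi\in\mathcal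 N,\|\Psi\|=1}|\langle\Psi,B,\Psi\rangle|+k\Big)^{-1}.$$ -/

import Mathlib

open MeasureTheory

noncomputable section

namespace DiracCritical

/-- Physical space `ℝ³`. -/
abbrev Space := EuclideanSpace ℝ (Fin 3)

/-- Four-component spinors `ℂ⁴`. -/
abbrev Spinor := EuclideanSpace ℂ (Fin 4)

/-- `4 × 4` matrices, acting on spinors, with the operator norm. -/
abbrev SpinorOp := Spinor →L[ℂ] Spinor

/-- `L^∞(ℝ³; ℂ⁴)`, normed by the essential supremum of the Euclidean length. -/
abbrev LInf := Lp Spinor ⊤ (volume : Measure Space)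

/-- The Dirac matrices `α₁, α₂, α₃`, built from the Pauli matrices in the order
`σ₁ = diag(1,-1)`, `σ₂ = [[0,1],[1,0]]`, `σ₃ = [[0,-i],[i,0]]`. -/
def alpha : Fin 3 → SpinorOp :=
  ![Matrix.toEuclideanCLM (n := Fin 4) (𝕜 := ℂ)
      !![0, 0, 1, 0; 0, 0, 0, -1; 1, 0, 0, 0; 0, -1, 0, 0],
    Matrix.toEuclideanCLM (n := Fin 4) (𝕜 := ℂ)
      !![0, 0, 0, 1; 0, 0, 1, 0; 0, 1, 0, 0; 1, 0, 0, 0],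
    Matrix.toEuclideanCLM (n := Fin 4) (𝕜 := ℂ)
      !![0, 0, 0, -Complex.I; 0, 0, Complex.I, 0; 0, -Complex.I, 0, 0; Complex.I, 0, 0, 0]]

/-- The Dirac matrix `β = diag(1,1,-1,-1)`. -/
def beta : SpinorOp :=
  Matrix.toEuclideanCLM (n := Fin 4) (𝕜 := ℂ)
    !![1, 0, 0, 0; 0, 1, 0, 0; 0, 0, -1, 0; 0, 0, 0, -1]

/-- `α · v = ∑ₗ vₗ αₗ`. -/
def alphaDot (v : Space) : SpinorOp := ∑ l : Fin 3, ((v l : ℝ) : ℂ) • alpha l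

/-- The energy `E_k = √(k² + 1)` of momentum `k`. -/
def energy (k : Space) : ℝ := Real.sqrt (‖k‖ ^ 2 + 1)

/-- The kernel `G⁺_E` of `(E - D⁰ + i0)⁻¹` for energies `E ≥ 1`, where `κ = √(E² - 1)` and
`x` on the right stands for `‖x‖`:
`G⁺_E = (4π)⁻¹ e^{iκx} ( - x⁻¹ (E + κ α·x̂ + β) - i x⁻² α·x̂ )`. -/
def green (E : ℝ) (x : Space) : SpinorOp :=
  ((1 / (4 * Real.pi) : ℝ) * Complex.exp (Complex.I * (Real.sqrt (E ^ 2 - 1) * ‖x‖ : ℝ)) : ℂ) •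
    (-(((‖x‖⁻¹ : ℝ) : ℂ) •
        (((E : ℝ) : ℂ) • (1 : SpinorOp)
          + ((Real.sqrt (E ^ 2 - 1) * ‖x‖⁻¹ : ℝ) : ℂ) • alphaDot x + beta))
      - (Complex.I * ((‖x‖⁻¹ ^ 2 * ‖x‖⁻¹ : ℝ) : ℂ)) • alphaDot x)

/-- `(T^V_E f)(x) = ∫ G⁺_E(x - y) V(y) f(y) d³y`. -/
def T (V : Space → SpinorOp) (E : ℝ) (f : Space → Spinor) (x : Space) : Spinor :=
  ∫ y, green E (x - y) (V y (f y))

/-- Membership in the space `ℬ` of bounded functions tending uniformly to zero at infinity. -/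
def VanishesAtInfinity (f : LInf) : Prop :=
  ∀ ε : ℝ, 0 < ε → ∃ R : ℝ, ∀ᵐ x : Space, R < ‖x‖ → ‖f x‖ < ε

/-- `𝒩 = {Φ ∈ ℬ : (1 - T^A_1) Φ = 0}`. -/
def zeroSpace (A : Space → SpinorOp) : Set LInf :=
  {Φ | VanishesAtInfinity Φ ∧ ∀ᵐ x : Space, Φ x = T A 1 Φ x}

/-- `⟨f, V, g⟩ = ∫ f†(x) V(x) g(x) d³x`. -/
def form (f : Space → Spinor) (V : Space → SpinorOp) (g : Space → Spinor) : ℂ :=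
  ∫ x, inner ℂ (f x) (V x (g x))

/-- `ℳ^⊥ = {m ∈ ℬ : ⟨m, A, Φ⟩ = 0 for all Φ ∈ 𝒩}`. -/
def orthoSpace (A : Space → SpinorOp) : Set LInf :=
  {m | VanishesAtInfinity m ∧ ∀ Φ ∈ zeroSpace A, form m A Φ = 0}

/-- `‖V‖₁`. -/
def normOne (V : Space → SpinorOp) : ℝ := (eLpNorm V 1 volume).toReal

/-- `‖V‖_∞`. -/
def normInf (V : Space → SpinorOp) : ℝ := (eLpNorm V ⊤ volume).toReal

/-- The class `𝒞` of critical potentials. -/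
structure CriticalClass (A : Space → SpinorOp) : Prop where
  selfAdjoint : ∀ x, IsSelfAdjoint (A x)
  critical : ∃ Φ ∈ zeroSpace A, Φ ≠ 0
  /-- Hölder continuity of degree one. -/
  lipschitz : ∃ L : NNReal, LipschitzWith L A
  decay_one : MemLp (fun x => (((1 + ‖x‖) ^ 2 : ℝ) : ℂ) • A x) 1 volume
  decay_inf : MemLp (fun x => (((1 + ‖x‖) ^ 2 : ℝ) : ℂ) • A x) ⊤ volume
  transversal : zeroSpace A ∩ orthoSpace A = {0}
  dichotomy : (∀ Φ ∈ zeroSpace A, MemLp Φ 2 volume) ∨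
    (∀ Φ ∈ zeroSpace A, MemLp Φ 2 volume → Φ = 0)
  moments : ∀ Φ ∈ zeroSpace A, Φ ≠ 0 →
    (∫ x, A x (Φ x)) ≠ 0 ∨
    ∃ l : Fin 3, ((1 : SpinorOp) - Complex.I • beta) (∫ x : Space, ((x l : ℝ) : ℂ) • A x (Φ x)) ≠ 0

/-- The resonance case: no nonzero element of `𝒩` is square integrable. -/
def ResonanceCase (A : Space → SpinorOp) : Prop :=
  ∀ Φ ∈ zeroSpace A, Φ ≠ 0 → ¬ MemLp Φ 2 volume

/-- The set `𝒲_K` of perturbations of `A`. The quotient in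
`‖Φ‖² (‖B‖₁ + ‖B‖_∞)² / |⟨Φ, B, Φ⟩| ≤ K` is multiplied out. -/
structure PerturbationClass (A : Space → SpinorOp) (K : ℝ) (B : Space → SpinorOp) : Prop where
  selfAdjoint : ∀ᵐ x : Space, IsSelfAdjoint (B x)
  memLp_one : MemLp B 1 volume
  memLp_inf : MemLp B ⊤ volume
  bound : ∀ Φ ∈ zeroSpace A, ‖Φ‖ ^ 2 * (normOne B + normInf B) ^ 2 ≤ K * ‖form Φ B Φ‖

/-- `inf {|⟨Ψ, B, Ψ⟩| : Ψ ∈ 𝒩, ‖Ψ‖ = 1}`. -/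
def formInf (A B : Space → SpinorOp) : ℝ :=
  sInf {r : ℝ | ∃ Ψ ∈ zeroSpace A, ‖Ψ‖ = 1 ∧ r = ‖form Ψ B Ψ‖}

/-- `s` is a normalized positive-energy spinor of momentum `k`, so that `e^{ik·x} s` is an
`L^∞`-normalized generalized eigenfunction of `D⁰` with energy `+E_k`. -/
def IsFreeSpinor (k : Space) (s : Spinor) : Prop :=
  ‖s‖ = 1 ∧ (alphaDot k + beta) s = ((energy k : ℝ) : ℂ) • s

/-- The free generalized eigenfunction `χ(x) = e^{ik·x} s`. -/
def planeWave (k : Space) (s : Spinor) (x : Space) : Spinor :=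
  Complex.exp (Complex.I * ((inner ℝ k x : ℝ) : ℂ)) • s

/-- `φ ∈ L^∞` solves the Lippmann–Schwinger equation `(1 - T^V_{E_k}) φ = χ`, `χ = e^{ik·x} s`. -/
def IsGeneralizedEigenfunction (V : Space → SpinorOp) (k : Space) (s : Spinor) (φ : LInf) : Prop :=
  ∀ᵐ x : Space, φ x = planeWave k s x + T V (energy k) φ x

end DiracCritical

end

open DiracCritical

/-! Write `κ = |k|`, `b = ‖B‖₁ + ‖B‖_∞`, `t = formInf A B`. The Lippmann–Schwinger operator is `1 -
T₁ - S`, where `T₁` is the threshold operator of `A` and `S = O(κ + b)` collects the change of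
energy and the potential `B`.

`T₁` is compact on `L^∞`, so its fixed space `𝒩` is finite dimensional. The Green function at `E =
1` is a Hermitian kernel, hence `⟨Φ, A, T₁ f⟩ = ⟨Φ, A, f⟩` for `Φ ∈ 𝒩` (`form_threshold`). By (c)
the form is nondegenerate on `𝒩`, which yields a projection `P` onto `𝒩` with `P T₁ = P`
(`exists_projection`). Then `1 - T₁ + P` is invertible, and every solution splits as `φ = Φ + m`
with `Φ = Pφ` and `‖m‖ ≤ c (‖χ‖ + ‖S‖ ‖Φ‖)` (`exists_reduction`).

It remains to bound `Φ`. Pairing the equation with `AΦ` removes `1 - T₁` and leaves `-⟨Φ, A, SΦ⟩ =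
⟨Φ, A, χ + S m⟩`. Up to `O(κ² + κb) ‖Φ‖²`, the left form is `⟨Φ, B, Φ⟩ - i κ/(8π) ‖(1+β)∫AΦ‖²`, up
to sign. The first term is real and the second imaginary, so they cannot cancel. The coefficient
`(1+β)∫AΦ` governs the `1/|x|` tail of `Φ`; if it vanished, `Φ` would be `O(|x|⁻²)` and square
integrable. In the resonance case it is therefore bounded below by a multiple of `‖Φ‖`
(`exists_leading_lower_bound`), and the form dominates `(κ + t) ‖Φ‖²` (`reduced_form_lower_bound`).

The term `S m` feeds back `‖S‖² ‖Φ‖`. The class `𝒲_K` gives `b² ≤ K t`, so for small `K` and `k₀`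
this is a small multiple of `(κ + t) ‖Φ‖` and is absorbed. The two bounds follow. With `χ = 0` they
give uniqueness, and the Fredholm alternative turns uniqueness into existence. -/

noncomputable section

namespace DiracCritical

/-! ### Convolution with weakly singular kernels -/

/-- `u` is integrable and essentially bounded, with both norms at most `N`. -/
structure IsSource {F : Type*} [NormedAddCommGroup F] (u : Space → F) (N : ℝ) : Prop where
  integrable : Integrable u
  ae_bound : ∀ᵐ y, ‖u y‖ ≤ N
  integral_le : ∫ y, ‖u y‖ ≤ N

/-- The weight `1 + |x|⁻²` that dominates all kernels in use. -/
def weight (x : Space) : ℝ := 1 + ‖x‖⁻¹ ^ 2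

lemma weight_nonneg (x : Space) : 0 ≤ weight x := by unfold weight; positivity

lemma one_le_weight (x : Space) : 1 ≤ weight x := by
  unfold weight; linarith [sq_nonneg (‖x‖⁻¹)]

lemma inv_norm_le_weight (x : Space) : ‖x‖⁻¹ ≤ weight x := by
  unfold weight; nlinarith [sq_nonneg (‖x‖⁻¹ - 1)]

lemma inv_norm_sq_le_weight (x : Space) : ‖x‖⁻¹ ^ 2 ≤ weight x := by
  unfold weight; linarith

lemma measurable_weight : Measurable weight := by unfold weight; fun_prop

/-- The singular part of the weight. -/
def singularPart (δ : ℝ) : Space → ℝ :=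
  Set.indicator (Metric.ball 0 δ) (fun z => ‖z‖⁻¹ ^ 2)

lemma singularPart_nonneg (δ : ℝ) (z : Space) : 0 ≤ singularPart δ z :=
  Set.indicator_nonneg (fun _ _ => by positivity) z

lemma integrable_singularPart (δ : ℝ) : Integrable (singularPart δ) := by
  unfold singularPart
  rw [integrable_indicator_iff measurableSet_ball]
  refine integrableOn_ball_of_norm_le_rpow (C := 1) (α := 2) (by simp) (by simp; norm_num) ?_
    (Measurable.aestronglyMeasurable (by fun_prop))
  refine Filter.Eventually.of_forall fun x => ?_
  rw [Real.rpow_neg (norm_nonneg _)]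
  simp

/-- The integral over a shrinking ball measures the cost of cutting off the singularity of the Green
function. -/
lemma tendsto_integral_singularPart :
    Filter.Tendsto (fun n : ℕ => ∫ z, singularPart (1 / ((n : ℝ) + 1)) z) Filter.atTop
      (nhds 0) := by
  have h := tendsto_integral_of_dominated_convergence
    (F := fun (n : ℕ) z => singularPart (1 / ((n : ℝ) + 1)) z) (f := fun _ => 0)
    (μ := volume) (singularPart 1)
    (fun n => (integrable_singularPart _).aestronglyMeasurable) (integrable_singularPart 1) ?_ ?_
  · simpa using h
  · intro n
    refine Filter.Eventually.of_forall fun z => ?_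
    rw [Real.norm_of_nonneg (singularPart_nonneg _ _)]
    refine Set.indicator_le_indicator_of_subset (Metric.ball_subset_ball ?_)
      (fun _ => by positivity) z
    rw [div_le_one (by positivity)]
    linarith [Nat.cast_nonneg (α := ℝ) n]
  · refine Filter.Eventually.of_forall fun z => ?_
    by_cases hz : z = 0
    · subst hz
      simp [singularPart, Set.indicator]
    · have hz' : 0 < ‖z‖ := norm_pos_iff.2 hz
      refine tendsto_const_nhds.congr' ?_
      have := (tendsto_one_div_add_atTop_nhds_zero_nat (𝕜 := ℝ)).eventually_lt_const hz'
      filter_upwards [this] with n hn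
      symm
      apply Set.indicator_of_notMem
      simpa using hn.le

/-- The constant of the weighted convolution estimate. -/
def weightConst : ℝ := 2 + ∫ z, singularPart 1 z

lemma weightConst_pos : 0 < weightConst := by
  have : 0 ≤ ∫ z, singularPart 1 z := integral_nonneg (singularPart_nonneg 1)
  unfold weightConst; linarith

lemma weight_le (z : Space) : weight z ≤ 2 + singularPart 1 z := by
  by_cases hz : z ∈ Metric.ball (0 : Space) 1
  · rw [singularPart, Set.indicator_of_mem hz]; unfold weight; linarith
  · rw [singularPart, Set.indicator_of_notMem hz]
    have h1 : 1 ≤ ‖z‖ := by simpa using hz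
    have : ‖z‖⁻¹ ≤ 1 := inv_le_one_of_one_le₀ h1
    have h0 : 0 ≤ ‖z‖⁻¹ := by positivity
    unfold weight; nlinarith

namespace IsSource

variable {F : Type*} [NormedAddCommGroup F] {u : Space → F} {N : ℝ}

lemma nonneg (hu : IsSource u N) : 0 ≤ N :=
  (integral_nonneg fun _ => norm_nonneg _).trans hu.integral_le

lemma mono {G : Type*} [NormedAddCommGroup G] {v : Space → G} {c : ℝ} (hc : 0 ≤ c)
    (hu : IsSource u N) (hv : AEStronglyMeasurable v) (h : ∀ᵐ y, ‖v y‖ ≤ c * ‖u y‖) :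
    IsSource v (c * N) where
  integrable := (hu.integrable.norm.const_mul c).mono' hv h
  ae_bound := by
    filter_upwards [h, hu.ae_bound] with y h1 h2
    exact h1.trans (mul_le_mul_of_nonneg_left h2 hc)
  integral_le := by
    calc ∫ y, ‖v y‖ ≤ ∫ y, c * ‖u y‖ :=
          integral_mono_ae ((hu.integrable.norm.const_mul c).mono' hv h).norm
            (hu.integrable.norm.const_mul c) h
      _ = c * ∫ y, ‖u y‖ := integral_const_mul _ _
      _ ≤ c * N := mul_le_mul_of_nonneg_left hu.integral_le hc

lemma integrable_singularPart_mul (hu : IsSource u N) (δ : ℝ) (x : Space) :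
    Integrable (fun y => singularPart δ (x - y) * ‖u y‖) ∧
      ∫ y, singularPart δ (x - y) * ‖u y‖ ≤ (∫ z, singularPart δ z) * N := by
  have h1 : Integrable (fun y => singularPart δ (x - y)) :=
    (integrable_singularPart δ).comp_sub_left x
  have hb : ∀ᵐ y, ‖singularPart δ (x - y) * ‖u y‖‖ ≤ singularPart δ (x - y) * N := by
    filter_upwards [hu.ae_bound] with y hy
    rw [norm_mul, norm_norm, Real.norm_of_nonneg (singularPart_nonneg _ _)]
    exact mul_le_mul_of_nonneg_left hy (singularPart_nonneg _ _)
  have hi : Integrable (fun y => singularPart δ (x - y) * ‖u y‖) :=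
    (h1.mul_const N).mono' (h1.aestronglyMeasurable.mul hu.integrable.aestronglyMeasurable.norm) hb
  refine ⟨hi, ?_⟩
  calc ∫ y, singularPart δ (x - y) * ‖u y‖ ≤ ∫ y, singularPart δ (x - y) * N := by
        refine integral_mono_ae hi (h1.mul_const N) ?_
        filter_upwards [hb] with y hy using (le_abs_self _).trans hy
    _ = (∫ z, singularPart δ z) * N := by
        rw [integral_mul_const, integral_sub_left_eq_self (singularPart δ) volume x]

/-- The bounded part of the weight is paired with the `L¹` norm of `u`, the locally integrable
singular part with its essential bound. This is why potentials are taken in `L¹ ∩ L^∞`. -/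
lemma integrable_weight_mul (hu : IsSource u N) (x : Space) :
    Integrable (fun y => weight (x - y) * ‖u y‖) ∧
      ∫ y, weight (x - y) * ‖u y‖ ≤ weightConst * N := by
  obtain ⟨hs, hs'⟩ := hu.integrable_singularPart_mul 1 x
  have hd : Integrable (fun y => 2 * ‖u y‖ + singularPart 1 (x - y) * ‖u y‖) :=
    (hu.integrable.norm.const_mul 2).add hs
  have hb : ∀ y, weight (x - y) * ‖u y‖ ≤ 2 * ‖u y‖ + singularPart 1 (x - y) * ‖u y‖ := by
    intro y
    rw [← add_mul]
    exact mul_le_mul_of_nonneg_right (weight_le _) (norm_nonneg _)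
  have hi : Integrable (fun y => weight (x - y) * ‖u y‖) := by
    refine hd.mono' ((measurable_weight.comp
      (measurable_const.sub measurable_id)).aestronglyMeasurable.mul
      hu.integrable.aestronglyMeasurable.norm) (Filter.Eventually.of_forall fun y => ?_)
    rw [Real.norm_of_nonneg (mul_nonneg (weight_nonneg _) (norm_nonneg _))]
    exact hb y
  refine ⟨hi, ?_⟩
  calc ∫ y, weight (x - y) * ‖u y‖
      ≤ ∫ y, (2 * ‖u y‖ + singularPart 1 (x - y) * ‖u y‖) := integral_mono hi hd hb
    _ = 2 * (∫ y, ‖u y‖) + ∫ y, singularPart 1 (x - y) * ‖u y‖ := by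
        rw [integral_add (hu.integrable.norm.const_mul 2) hs, integral_const_mul]
    _ ≤ weightConst * N := by
        unfold weightConst
        have := hu.integral_le
        linarith

end IsSource

/-- A measurable kernel dominated by a multiple of the weight. -/
structure IsKernel (H : Space → SpinorOp) (C : ℝ) : Prop where
  measurable : StronglyMeasurable H
  bound : ∀ x, ‖H x‖ ≤ C * weight x

/-- The convolution of a matrix kernel with a spinor field. -/
def conv (H : Space → SpinorOp) (u : Space → Spinor) (x : Space) : Spinor :=
  ∫ y, H (x - y) (u y)

namespace IsKernel

variable {H H' : Space → SpinorOp} {C C' N : ℝ} {u v : Space → Spinor}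

lemma nonneg (hH : IsKernel H C) : 0 ≤ C := by
  have h := (norm_nonneg _).trans (hH.bound 0)
  -- The convention `0⁻¹ = 0` makes the weight finite at the origin.
  have : weight 0 = 1 := by simp [weight]
  rwa [this, mul_one] at h

lemma norm_apply_le (hH : IsKernel H C) (u : Space → Spinor) (x y : Space) :
    ‖H (x - y) (u y)‖ ≤ C * (weight (x - y) * ‖u y‖) := by
  rw [← mul_assoc]
  exact ((H (x - y)).le_opNorm _).trans
    (mul_le_mul_of_nonneg_right (hH.bound _) (norm_nonneg _))

lemma aestronglyMeasurable_prod (hH : IsKernel H C) (hu : AEStronglyMeasurable u) :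
    AEStronglyMeasurable (fun p : Space × Space => H (p.1 - p.2) (u p.2))
      ((volume : Measure Space).prod volume) := by
  have h1 : AEStronglyMeasurable (fun p : Space × Space => H (p.1 - p.2))
      ((volume : Measure Space).prod volume) :=
    (hH.measurable.comp_measurable (by fun_prop :
      Measurable fun p : Space × Space => p.1 - p.2)).aestronglyMeasurable
  exact (ContinuousLinearMap.apply ℂ Spinor).flip.aestronglyMeasurable_comp₂ h1 hu.comp_snd

lemma aestronglyMeasurable_apply (hH : IsKernel H C) (hu : AEStronglyMeasurable u) (x : Space) :
    AEStronglyMeasurable (fun y => H (x - y) (u y)) := by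
  have h1 : AEStronglyMeasurable (fun y => H (x - y)) :=
    (hH.measurable.comp_measurable (by fun_prop :
      Measurable fun y : Space => x - y)).aestronglyMeasurable
  exact (ContinuousLinearMap.apply ℂ Spinor).flip.aestronglyMeasurable_comp₂ h1 hu

lemma integrable_apply (hH : IsKernel H C) (hu : IsSource u N) (x : Space) :
    Integrable (fun y => H (x - y) (u y)) :=
  ((hu.integrable_weight_mul x).1.const_mul C).mono'
    (hH.aestronglyMeasurable_apply hu.integrable.aestronglyMeasurable x)
    (Filter.Eventually.of_forall fun y => hH.norm_apply_le u x y)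

lemma integral_norm_le (hH : IsKernel H C) (hu : IsSource u N) (x : Space) :
    ∫ y, ‖H (x - y) (u y)‖ ≤ C * weightConst * N := by
  calc ∫ y, ‖H (x - y) (u y)‖ ≤ ∫ y, C * (weight (x - y) * ‖u y‖) :=
        integral_mono (hH.integrable_apply hu x).norm
          ((hu.integrable_weight_mul x).1.const_mul C) fun y => hH.norm_apply_le u x y
    _ = C * ∫ y, weight (x - y) * ‖u y‖ := integral_const_mul _ _
    _ ≤ C * (weightConst * N) :=
        mul_le_mul_of_nonneg_left (hu.integrable_weight_mul x).2 hH.nonneg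
    _ = C * weightConst * N := by ring

lemma norm_conv_le (hH : IsKernel H C) (hu : IsSource u N) (x : Space) :
    ‖conv H u x‖ ≤ C * weightConst * N :=
  (norm_integral_le_integral_norm _).trans (hH.integral_norm_le hu x)

lemma aestronglyMeasurable_conv (hH : IsKernel H C) (hu : AEStronglyMeasurable u) :
    AEStronglyMeasurable (conv H u) :=
  (hH.aestronglyMeasurable_prod hu).integral_prod_right'

lemma conv_add (hH : IsKernel H C) {N' : ℝ} (hu : IsSource u N) (hv : IsSource v N') (x : Space) :
    conv H (fun y => u y + v y) x = conv H u x + conv H v x := by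
  simp only [conv, map_add]
  exact integral_add (hH.integrable_apply hu x) (hH.integrable_apply hv x)

lemma conv_sub_kernel (hH : IsKernel H C) (hH' : IsKernel H' C') (hu : IsSource u N) (x : Space) :
    conv (fun z => H z - H' z) u x = conv H u x - conv H' u x := by
  simp only [conv, sub_apply]
  exact integral_sub (hH.integrable_apply hu x) (hH'.integrable_apply hu x)

end IsKernel

lemma conv_congr_ae {H : Space → SpinorOp} {u v : Space → Spinor} (h : u =ᵐ[volume] v)
    (x : Space) : conv H u x = conv H v x := by
  refine integral_congr_ae ?_
  filter_upwards [h] with y hy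
  rw [hy]

/-! ### Essentially bounded fields -/

lemma ae_norm_le_toReal_eLpNorm {F : Type*} [NormedAddCommGroup F] {f : Space → F}
    (hf : MemLp f ⊤ volume) : ∀ᵐ x, ‖f x‖ ≤ (eLpNorm f ⊤ volume).toReal := by
  have h := ae_le_eLpNormEssSup (f := f) (μ := volume)
  filter_upwards [h] with x hx
  rw [← toReal_enorm]
  exact ENNReal.toReal_mono hf.2.ne (by simpa using hx)

lemma LInf.ae_norm_le (f : LInf) : ∀ᵐ x, ‖f x‖ ≤ ‖f‖ := ae_norm_le_toReal_eLpNorm (Lp.memLp f)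

lemma LInf.norm_le_of_ae_bound {f : LInf} {C : ℝ} (hC : 0 ≤ C) (h : ∀ᵐ x, ‖f x‖ ≤ C) :
    ‖f‖ ≤ C := by
  rw [Lp.norm_def, eLpNorm_exponent_top]
  exact ENNReal.toReal_le_of_le_ofReal hC (eLpNormEssSup_le_of_ae_bound h)

lemma isSource_of_memLp {V : Space → SpinorOp} (h1 : MemLp V 1 volume) (h2 : MemLp V ⊤ volume) :
    IsSource V (normOne V + normInf V) where
  integrable := memLp_one_iff_integrable.1 h1
  ae_bound := by
    filter_upwards [ae_norm_le_toReal_eLpNorm h2] with x hx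
    have : 0 ≤ normOne V := ENNReal.toReal_nonneg
    unfold normInf; linarith
  integral_le := by
    have : ∫ y, ‖V y‖ = normOne V := by
      rw [normOne, eLpNorm_one_eq_lintegral_enorm, integral_norm_eq_lintegral_enorm h1.1]
    rw [this]
    have : 0 ≤ normInf V := ENNReal.toReal_nonneg
    linarith

lemma aestronglyMeasurable_apply_field {V : Space → SpinorOp} {f : Space → Spinor}
    (hV : AEStronglyMeasurable V) (hf : AEStronglyMeasurable f) :
    AEStronglyMeasurable (fun y => V y (f y)) :=
  (ContinuousLinearMap.apply ℂ Spinor).flip.aestronglyMeasurable_comp₂ hV hf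

lemma IsSource.apply {V : Space → SpinorOp} {N : ℝ} (hV : IsSource V N) (f : LInf) :
    IsSource (fun y => V y (f y)) (‖f‖ * N) := by
  refine hV.mono (norm_nonneg _) (aestronglyMeasurable_apply_field
    hV.integrable.aestronglyMeasurable (Lp.aestronglyMeasurable f)) ?_
  filter_upwards [LInf.ae_norm_le f] with y hy
  rw [mul_comm]
  exact ((V y).le_opNorm _).trans (mul_le_mul_of_nonneg_left hy (norm_nonneg _))

/-- Convolution with a kernel, preceded by a potential, is bounded on `L^∞`. -/
theorem exists_kernelOp {H : Space → SpinorOp} {V : Space → SpinorOp} {C N : ℝ}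
    (hH : IsKernel H C) (hV : IsSource V N) :
    ∃ Θ : LInf →L[ℂ] LInf, (∀ f : LInf, ∀ᵐ x, Θ f x = conv H (fun y => V y (f y)) x) ∧
      ‖Θ‖ ≤ C * weightConst * N := by
  have hmem : ∀ f : LInf, MemLp (conv H (fun y => V y (f y))) ⊤ volume := fun f =>
    memLp_top_of_bound (hH.aestronglyMeasurable_conv (hV.apply f).integrable.aestronglyMeasurable)
      _ (Filter.Eventually.of_forall fun x => hH.norm_conv_le (hV.apply f) x)
  have hC : 0 ≤ C * weightConst * N :=
    mul_nonneg (mul_nonneg hH.nonneg weightConst_pos.le) hV.nonneg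
  let Θ₀ : LInf →ₗ[ℂ] LInf :=
    { toFun := fun f => (hmem f).toLp _
      map_add' := fun f g => by
        rw [← MemLp.toLp_add]
        refine MemLp.toLp_congr _ _ (Filter.Eventually.of_forall fun x => ?_)
        rw [Pi.add_apply, ← hH.conv_add (hV.apply f) (hV.apply g)]
        refine conv_congr_ae ?_ x
        filter_upwards [Lp.coeFn_add f g] with y hy
        rw [hy, Pi.add_apply, map_add]
      map_smul' := fun c f => by
        rw [RingHom.id_apply, ← MemLp.toLp_const_smul]
        refine MemLp.toLp_congr _ _ (Filter.Eventually.of_forall fun x => ?_)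
        have : conv H (fun y => V y ((c • f : LInf) y)) x =
            conv H (fun y => c • V y (f y)) x := by
          refine conv_congr_ae ?_ x
          filter_upwards [Lp.coeFn_smul c f] with y hy
          rw [hy, Pi.smul_apply, map_smul]
        rw [this]
        simp only [conv, map_smul, Pi.smul_apply]
        exact integral_smul c _ }
  have hb : ∀ f, ‖Θ₀ f‖ ≤ C * weightConst * N * ‖f‖ := fun f => by
    refine LInf.norm_le_of_ae_bound (mul_nonneg hC (norm_nonneg _)) ?_
    filter_upwards [(hmem f).coeFn_toLp] with x hx
    change ‖((hmem f).toLp _ : LInf) x‖ ≤ _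
    rw [hx]
    refine (hH.norm_conv_le (hV.apply f) x).trans (le_of_eq (by ring))
  exact ⟨Θ₀.mkContinuous _ hb, fun f => (hmem f).coeFn_toLp, Θ₀.mkContinuous_norm_le hC hb⟩

/-! ### The free Green function -/

lemma alpha_isSelfAdjoint (l : Fin 3) : IsSelfAdjoint (alpha l) := by
  unfold alpha
  fin_cases l <;>
  · refine IsSelfAdjoint.map ?_ (Matrix.toEuclideanCLM (n := Fin 4) (𝕜 := ℂ))
    ext i j
    fin_cases i <;> fin_cases j <;> simp

lemma beta_isSelfAdjoint : IsSelfAdjoint beta := by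
  unfold beta
  refine IsSelfAdjoint.map ?_ (Matrix.toEuclideanCLM (n := Fin 4) (𝕜 := ℂ))
  ext i j
  fin_cases i <;> fin_cases j <;> simp

lemma beta_mul_self : beta * beta = 1 := by
  unfold beta
  rw [← map_mul, ← map_one (Matrix.toEuclideanCLM (n := Fin 4) (𝕜 := ℂ))]
  congr 1
  ext i j
  fin_cases i <;> fin_cases j <;> simp [Matrix.mul_apply, Fin.sum_univ_four]

lemma alphaDot_isSelfAdjoint (v : Space) : IsSelfAdjoint (alphaDot v) := by
  unfold alphaDot
  refine isSelfAdjoint_sum (R := SpinorOp) Finset.univ fun l _ => ?_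
  refine IsSelfAdjoint.smul ?_ (alpha_isSelfAdjoint l)
  exact Complex.conj_ofReal _

lemma alphaDot_neg (v : Space) : alphaDot (-v) = -alphaDot v := by
  simp only [alphaDot, PiLp.neg_apply, Complex.ofReal_neg, Fin.sum_univ_three]
  module

/-- A common bound for the norms of the Dirac matrices. -/
def diracConst : ℝ := 1 + ‖beta‖ + ∑ l : Fin 3, ‖alpha l‖

lemma one_le_diracConst : 1 ≤ diracConst := by
  have := norm_nonneg beta
  have : 0 ≤ ∑ l : Fin 3, ‖alpha l‖ := Finset.sum_nonneg fun _ _ => norm_nonneg _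
  unfold diracConst; linarith

lemma norm_one_le_diracConst : ‖(1 : SpinorOp)‖ ≤ diracConst :=
  ContinuousLinearMap.norm_id_le.trans one_le_diracConst

lemma norm_beta_le_diracConst : ‖beta‖ ≤ diracConst := by
  have : 0 ≤ ∑ l : Fin 3, ‖alpha l‖ := Finset.sum_nonneg fun _ _ => norm_nonneg _
  unfold diracConst; linarith

lemma norm_alphaDot_le (v : Space) : ‖alphaDot v‖ ≤ diracConst * ‖v‖ := by
  calc ‖alphaDot v‖ ≤ ∑ l : Fin 3, ‖((v l : ℝ) : ℂ) • alpha l‖ := norm_sum_le _ _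
    _ ≤ ∑ l : Fin 3, ‖alpha l‖ * ‖v‖ := by
        refine Finset.sum_le_sum fun l _ => ?_
        rw [norm_smul, mul_comm, Complex.norm_real]
        exact mul_le_mul_of_nonneg_left (PiLp.norm_apply_le v l) (norm_nonneg _)
    _ = (∑ l : Fin 3, ‖alpha l‖) * ‖v‖ := by rw [Finset.sum_mul]
    _ ≤ diracConst * ‖v‖ := by
        refine mul_le_mul_of_nonneg_right ?_ (norm_nonneg _)
        have := norm_nonneg beta
        unfold diracConst; linarith

lemma measurable_alphaDot : Measurable alphaDot := by
  unfold alphaDot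
  refine Finset.measurable_sum _ fun l _ => ?_
  have : Measurable fun v : Space => ((v l : ℝ) : ℂ) := by fun_prop
  exact this.smul_const _

lemma measurable_green (E : ℝ) : Measurable (green E) := by
  have h := measurable_alphaDot
  unfold green
  fun_prop

lemma green_one (x : Space) : green 1 x = ((1 / (4 * Real.pi) : ℝ) : ℂ) •
    (-(((‖x‖⁻¹ : ℝ) : ℂ) • ((1 : SpinorOp) + beta))
      - (Complex.I * ((‖x‖⁻¹ ^ 2 * ‖x‖⁻¹ : ℝ) : ℂ)) • alphaDot x) := by
  have h : Real.sqrt ((1 : ℝ) ^ 2 - 1) = 0 := by simp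
  rw [green, h]
  push_cast
  simp only [zero_mul, mul_zero, Complex.exp_zero]
  module

/-- The Dirac matrices are Hermitian; conjugating the factor `i` changes the sign of the `α·x` term,
and so does `x ↦ -x`. -/
lemma adjoint_green_one (x : Space) :
    ContinuousLinearMap.adjoint (green 1 x) = green 1 (-x) := by
  rw [← ContinuousLinearMap.star_eq_adjoint, green_one, green_one, alphaDot_neg, norm_neg]
  have hα := (alphaDot_isSelfAdjoint x).star_eq
  have hβ := beta_isSelfAdjoint.star_eq
  simp only [star_smul, star_sub, star_neg, star_add, star_one, hα, hβ, star_mul']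
  simp only [Complex.star_def, Complex.conj_ofReal, Complex.conj_I]
  module

/-! ### Expansion of the Green function in the wave number. -/

lemma sqrt_energy_sq_sub_one {κ : ℝ} (hκ : 0 ≤ κ) :
    Real.sqrt (Real.sqrt (κ ^ 2 + 1) ^ 2 - 1) = κ := by
  rw [Real.sq_sqrt (by positivity), add_sub_cancel_right, Real.sqrt_sq hκ]

lemma sqrt_sq_add_one_sub_one_le (κ : ℝ) :
    0 ≤ Real.sqrt (κ ^ 2 + 1) - 1 ∧ Real.sqrt (κ ^ 2 + 1) - 1 ≤ κ ^ 2 := by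
  constructor
  · rw [sub_nonneg, Real.one_le_sqrt]; nlinarith [sq_nonneg κ]
  · rw [sub_le_iff_le_add, Real.sqrt_le_left (by positivity)]; nlinarith [sq_nonneg (κ ^ 2)]

lemma norm_one_div_four_pi_smul_le (X : SpinorOp) :
    ‖((1 / (4 * Real.pi) : ℝ) : ℂ) • X‖ ≤ ‖X‖ := by
  rw [norm_smul, Complex.norm_real, Real.norm_of_nonneg (by positivity)]
  refine mul_le_of_le_one_left (norm_nonneg _) ?_
  rw [div_le_one (by positivity)]
  linarith [Real.pi_gt_three]

lemma green_sub_green_one {κ : ℝ} (hκ : 0 ≤ κ) (x : Space) :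
    green (Real.sqrt (κ ^ 2 + 1)) x - green 1 x = ((1 / (4 * Real.pi) : ℝ) : ℂ) •
      (-((((‖x‖⁻¹ : ℝ) : ℂ) * ((Real.sqrt (κ ^ 2 + 1) : ℝ) *
          Complex.exp (Complex.I * (κ * ‖x‖ : ℝ)) - 1)) • (1 : SpinorOp))
        - (((‖x‖⁻¹ : ℝ) : ℂ) * (Complex.exp (Complex.I * (κ * ‖x‖ : ℝ)) - 1)) • beta
        - (((‖x‖⁻¹ : ℝ) : ℂ) * (Complex.exp (Complex.I * (κ * ‖x‖ : ℝ)) * (κ * ‖x‖⁻¹ : ℝ)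
          + Complex.I * (‖x‖⁻¹ ^ 2 : ℝ) * (Complex.exp (Complex.I * (κ * ‖x‖ : ℝ)) - 1))) •
            alphaDot x) := by
  rw [green_one, green, sqrt_energy_sq_sub_one hκ]
  push_cast
  module

/-- The prefactor `‖x‖⁻¹` compensates the size of `alphaDot x`, so that kernel estimates reduce to
three scalar ones. -/
lemma norm_three_term_le (a b c : ℂ) (x : Space) :
    ‖-(a • (1 : SpinorOp)) - b • beta - (((‖x‖⁻¹ : ℝ) : ℂ) * c) • alphaDot x‖ ≤
      diracConst * (‖a‖ + ‖b‖ + ‖c‖) := by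
  have hD := one_le_diracConst
  have h1 : ‖a • (1 : SpinorOp)‖ ≤ diracConst * ‖a‖ := by
    rw [norm_smul, mul_comm]
    exact mul_le_mul_of_nonneg_right norm_one_le_diracConst (norm_nonneg _)
  have h2 : ‖b • beta‖ ≤ diracConst * ‖b‖ := by
    rw [norm_smul, mul_comm]
    exact mul_le_mul_of_nonneg_right norm_beta_le_diracConst (norm_nonneg _)
  have h3 : ‖(((‖x‖⁻¹ : ℝ) : ℂ) * c) • alphaDot x‖ ≤ diracConst * ‖c‖ := by
    rw [norm_smul, norm_mul, Complex.norm_real, norm_inv, norm_norm]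
    have hx : ‖x‖⁻¹ * ‖x‖ ≤ 1 := inv_mul_le_one
    calc ‖x‖⁻¹ * ‖c‖ * ‖alphaDot x‖ ≤ ‖x‖⁻¹ * ‖c‖ * (diracConst * ‖x‖) := by
          gcongr; exact norm_alphaDot_le x
      _ = diracConst * ‖c‖ * (‖x‖⁻¹ * ‖x‖) := by ring
      _ ≤ diracConst * ‖c‖ * 1 := by gcongr
      _ = _ := mul_one _
  calc _ ≤ ‖a • (1 : SpinorOp)‖ + ‖b • beta‖ + ‖(((‖x‖⁻¹ : ℝ) : ℂ) * c) • alphaDot x‖ := by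
        refine (norm_sub_le _ _).trans (add_le_add_left ((norm_sub_le _ _).trans ?_) _)
        rw [norm_neg]
    _ ≤ _ := by linarith

/-- The bound must hold for all `t`, since `t = κ‖x‖` is unbounded; for `|t| ≥ 1` the crude bound
`2|t|` suffices. -/
lemma norm_exp_sub_one_sub_le (t : ℝ) :
    ‖Complex.exp (Complex.I * t) - 1 - Complex.I * t‖ ≤ 3 * t ^ 2 := by
  have hn : ‖Complex.I * (t : ℂ)‖ = |t| := by simp
  rcases le_total |t| 1 with h | h
  · refine (Complex.norm_exp_sub_one_sub_id_le (by rwa [hn])).trans ?_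
    rw [hn, sq_abs]; nlinarith [sq_nonneg t]
  · refine (norm_sub_le _ _).trans ?_
    rw [hn]
    have h1 : ‖Complex.exp (Complex.I * t) - 1‖ ≤ |t| :=
      Real.norm_exp_I_mul_ofReal_sub_one_le
    nlinarith [sq_abs t]

/-- The constant in the estimates of the Green function. -/
def greenConst : ℝ := 20 * diracConst

lemma greenConst_pos : 0 < greenConst := by
  have := one_le_diracConst
  unfold greenConst; linarith

lemma isKernel_green_one : IsKernel (green 1) greenConst where
  measurable := (measurable_green 1).stronglyMeasurable
  bound x := by
    have h : green 1 x = ((1 / (4 * Real.pi) : ℝ) : ℂ) •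
        (-((((‖x‖⁻¹ : ℝ) : ℂ)) • (1 : SpinorOp)) - (((‖x‖⁻¹ : ℝ) : ℂ)) • beta
          - (((‖x‖⁻¹ : ℝ) : ℂ) * (Complex.I * ((‖x‖⁻¹ ^ 2 : ℝ) : ℂ))) • alphaDot x) := by
      rw [green_one]; push_cast; module
    rw [h]
    refine (norm_one_div_four_pi_smul_le _).trans ((norm_three_term_le _ _ _ _).trans ?_)
    have e1 : ‖((‖x‖⁻¹ : ℝ) : ℂ)‖ = ‖x‖⁻¹ := by simp
    have e2 : ‖Complex.I * ((‖x‖⁻¹ ^ 2 : ℝ) : ℂ)‖ = ‖x‖⁻¹ ^ 2 := by simp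
    rw [e1, e2, greenConst]
    nlinarith [inv_norm_le_weight x, inv_norm_sq_le_weight x, one_le_diracConst, weight_nonneg x,
      mul_nonneg (sub_nonneg.2 (one_le_diracConst)) (weight_nonneg x),
      mul_le_mul_of_nonneg_left (inv_norm_le_weight x) (zero_le_one.trans one_le_diracConst),
      mul_le_mul_of_nonneg_left (inv_norm_sq_le_weight x) (zero_le_one.trans one_le_diracConst)]

/-- The inequality `|e^{iκr} - 1| ≤ κr` trades one power of `r⁻¹` for a factor `κ`. The difference
is thus `O(κ(1 + r⁻¹))`, without growth at infinity, so no moments of the potential are needed. -/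
lemma isKernel_green_sub {κ : ℝ} (hκ : 0 ≤ κ) (hκ1 : κ ≤ 1) :
    IsKernel (fun x => green (Real.sqrt (κ ^ 2 + 1)) x - green 1 x) (greenConst * κ) where
  measurable := ((measurable_green _).sub (measurable_green _)).stronglyMeasurable
  bound x := by
    rw [green_sub_green_one hκ]
    refine (norm_one_div_four_pi_smul_le _).trans ((norm_three_term_le _ _ _ _).trans ?_)
    set e := Complex.exp (Complex.I * (κ * ‖x‖ : ℝ)) with he
    have he1 : ‖e - 1‖ ≤ κ * ‖x‖ := by
      refine (Real.norm_exp_I_mul_ofReal_sub_one_le).trans (le_of_eq ?_)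
      exact Real.norm_of_nonneg (by positivity)
    have hen : ‖e‖ = 1 := Complex.norm_exp_I_mul_ofReal _
    obtain ⟨hE0, hE1⟩ := sqrt_sq_add_one_sub_one_le κ
    set E := Real.sqrt (κ ^ 2 + 1) with hE
    have hr : 0 ≤ ‖x‖⁻¹ := by positivity
    have hx : ‖x‖⁻¹ * ‖x‖ ≤ 1 := inv_mul_le_one
    have hEe : ‖(E : ℂ) * e - 1‖ ≤ κ ^ 2 + κ * ‖x‖ := by
      have : (E : ℂ) * e - 1 = ((E - 1 : ℝ) : ℂ) * e + (e - 1) := by push_cast; ring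
      rw [this]
      refine (norm_add_le _ _).trans (add_le_add ?_ he1)
      rw [norm_mul, hen, mul_one, Complex.norm_real, Real.norm_of_nonneg hE0]
      exact hE1
    have h1 : ‖((‖x‖⁻¹ : ℝ) : ℂ) * ((E : ℂ) * e - 1)‖ ≤ κ * ‖x‖⁻¹ + κ := by
      rw [norm_mul, Complex.norm_real, Real.norm_of_nonneg hr]
      calc _ ≤ ‖x‖⁻¹ * (κ ^ 2 + κ * ‖x‖) := by gcongr
        _ = ‖x‖⁻¹ * (κ * κ) + κ * (‖x‖⁻¹ * ‖x‖) := by ring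
        _ ≤ ‖x‖⁻¹ * (κ * 1) + κ * 1 := by gcongr
        _ = _ := by ring
    have h2 : ‖((‖x‖⁻¹ : ℝ) : ℂ) * (e - 1)‖ ≤ κ := by
      rw [norm_mul, Complex.norm_real, Real.norm_of_nonneg hr]
      calc _ ≤ ‖x‖⁻¹ * (κ * ‖x‖) := by gcongr
        _ = κ * (‖x‖⁻¹ * ‖x‖) := by ring
        _ ≤ κ * 1 := by gcongr
        _ = _ := by ring
    have h3 : ‖e * (κ * ‖x‖⁻¹ : ℝ) + Complex.I * (‖x‖⁻¹ ^ 2 : ℝ) * (e - 1)‖ ≤ 2 * (κ * ‖x‖⁻¹) := by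
      refine (norm_add_le _ _).trans ?_
      rw [norm_mul, hen, one_mul, norm_mul, norm_mul, Complex.norm_I, one_mul, Complex.norm_real,
        Complex.norm_real, Real.norm_of_nonneg (by positivity), Real.norm_of_nonneg (by positivity)]
      have : ‖x‖⁻¹ ^ 2 * ‖e - 1‖ ≤ κ * ‖x‖⁻¹ := by
        calc _ ≤ ‖x‖⁻¹ ^ 2 * (κ * ‖x‖) := by gcongr
          _ = κ * ‖x‖⁻¹ * (‖x‖⁻¹ * ‖x‖) := by ring
          _ ≤ κ * ‖x‖⁻¹ * 1 := by gcongr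
          _ = _ := by ring
      linarith
    have hD := one_le_diracConst
    calc _ ≤ diracConst * ((κ * ‖x‖⁻¹ + κ) + κ + 2 * (κ * ‖x‖⁻¹)) := by gcongr
      _ = diracConst * κ * (3 * ‖x‖⁻¹ + 2 * 1) := by ring
      _ ≤ diracConst * κ * (3 * weight x + 2 * weight x) := by
          gcongr
          · exact inv_norm_le_weight x
          · exact one_le_weight x
      _ ≤ greenConst * κ * weight x := by
          rw [greenConst]
          have := mul_nonneg (mul_nonneg (zero_le_one.trans hD) hκ) (weight_nonneg x)
          nlinarith

lemma isKernel_green {κ : ℝ} (hκ : 0 ≤ κ) (hκ1 : κ ≤ 1) :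
    IsKernel (green (Real.sqrt (κ ^ 2 + 1))) (2 * greenConst) where
  measurable := (measurable_green _).stronglyMeasurable
  bound x := by
    have h1 := (isKernel_green_sub hκ hκ1).bound x
    have h2 := isKernel_green_one.bound x
    have h3 := norm_le_norm_sub_add (green (Real.sqrt (κ ^ 2 + 1)) x) (green 1 x)
    have h4 : greenConst * κ * weight x ≤ greenConst * weight x := by
      have := mul_le_mul_of_nonneg_left hκ1 (mul_nonneg greenConst_pos.le (weight_nonneg x))
      linarith
    linarith

/-- First-order expansion of the Green function at the threshold. -/
lemma norm_green_expansion_le {κ : ℝ} (hκ : 0 ≤ κ) {x : Space} (hx0 : x ≠ 0) :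
    ‖green (Real.sqrt (κ ^ 2 + 1)) x - green 1 x
        + (((1 / (4 * Real.pi) : ℝ) : ℂ) * (Complex.I * (κ : ℂ))) • ((1 : SpinorOp) + beta)‖
      ≤ greenConst * κ ^ 2 * (‖x‖ + weight x) := by
  have hr0 : 0 < ‖x‖ := norm_pos_iff.2 hx0
  have hxx : ‖x‖⁻¹ * ‖x‖ = 1 := inv_mul_cancel₀ hr0.ne'
  have hxc : ((‖x‖ : ℝ) : ℂ) ≠ 0 := by exact_mod_cast hr0.ne'
  set e := Complex.exp (Complex.I * (κ * ‖x‖ : ℝ)) with he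
  obtain ⟨hE0, hE1⟩ := sqrt_sq_add_one_sub_one_le κ
  -- The added constant matrix removes the linear term of the exponential from the coefficients of
  -- `1` and `β`. In the `α` coefficient the linear terms cancel by themselves: `κr e + i(e - 1) =
  -- κr(e - 1) + i(e - 1 - iκr)`.
  have key : green (Real.sqrt (κ ^ 2 + 1)) x - green 1 x
        + (((1 / (4 * Real.pi) : ℝ) : ℂ) * (Complex.I * (κ : ℂ))) • ((1 : SpinorOp) + beta) =
      ((1 / (4 * Real.pi) : ℝ) : ℂ) •
      (-((((‖x‖⁻¹ : ℝ) : ℂ) * (((Real.sqrt (κ ^ 2 + 1) - 1 : ℝ) : ℂ) * e +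
          (e - 1 - Complex.I * (κ * ‖x‖ : ℝ)))) • (1 : SpinorOp))
        - (((‖x‖⁻¹ : ℝ) : ℂ) * (e - 1 - Complex.I * (κ * ‖x‖ : ℝ))) • beta
        - (((‖x‖⁻¹ : ℝ) : ℂ) * (((‖x‖⁻¹ ^ 2 : ℝ) : ℂ) * ((κ * ‖x‖ : ℝ) * (e - 1)
          + Complex.I * (e - 1 - Complex.I * (κ * ‖x‖ : ℝ))))) • alphaDot x) := by
    rw [green_sub_green_one hκ, ← he]
    clear_value e
    push_cast
    match_scalars
    · field_simp
      ring
    · field_simp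
      ring
    · field_simp
      ring_nf
      simp [Complex.I_sq]
  rw [key]
  refine (norm_one_div_four_pi_smul_le _).trans ((norm_three_term_le _ _ _ _).trans ?_)
  have he1 : ‖e - 1‖ ≤ κ * ‖x‖ := by
    refine (Real.norm_exp_I_mul_ofReal_sub_one_le).trans (le_of_eq ?_)
    exact Real.norm_of_nonneg (by positivity)
  have he2 : ‖e - 1 - Complex.I * (κ * ‖x‖ : ℝ)‖ ≤ 3 * (κ * ‖x‖) ^ 2 := norm_exp_sub_one_sub_le _
  have hen : ‖e‖ = 1 := Complex.norm_exp_I_mul_ofReal _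
  set E := Real.sqrt (κ ^ 2 + 1) with hE
  set d := e - 1 - Complex.I * (κ * ‖x‖ : ℝ) with hd
  have hr : 0 ≤ ‖x‖⁻¹ := by positivity
  have h2 : ‖((‖x‖⁻¹ : ℝ) : ℂ) * d‖ ≤ 3 * κ ^ 2 * ‖x‖ := by
    rw [norm_mul, Complex.norm_real, Real.norm_of_nonneg hr]
    calc _ ≤ ‖x‖⁻¹ * (3 * (κ * ‖x‖) ^ 2) := by gcongr
      _ = 3 * κ ^ 2 * ‖x‖ * (‖x‖⁻¹ * ‖x‖) := by ring
      _ = _ := by rw [hxx, mul_one]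
  have h1 : ‖((‖x‖⁻¹ : ℝ) : ℂ) * (((E - 1 : ℝ) : ℂ) * e + d)‖ ≤
      κ ^ 2 * ‖x‖⁻¹ + 3 * κ ^ 2 * ‖x‖ := by
    rw [mul_add]
    refine (norm_add_le _ _).trans (add_le_add ?_ h2)
    rw [norm_mul, norm_mul, hen, mul_one, Complex.norm_real, Real.norm_of_nonneg hr,
      Complex.norm_real, Real.norm_of_nonneg hE0, mul_comm]
    gcongr
  have h3 : ‖((‖x‖⁻¹ ^ 2 : ℝ) : ℂ) * ((κ * ‖x‖ : ℝ) * (e - 1) + Complex.I * d)‖ ≤ 4 * κ ^ 2 := by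
    rw [norm_mul, Complex.norm_real, Real.norm_of_nonneg (by positivity)]
    have : ‖((κ * ‖x‖ : ℝ) : ℂ) * (e - 1) + Complex.I * d‖ ≤ 4 * (κ * ‖x‖) ^ 2 := by
      refine (norm_add_le _ _).trans ?_
      rw [norm_mul, norm_mul, Complex.norm_I, one_mul, Complex.norm_real,
        Real.norm_of_nonneg (by positivity)]
      have := mul_le_mul_of_nonneg_left he1 (by positivity : 0 ≤ κ * ‖x‖)
      linarith
    calc _ ≤ ‖x‖⁻¹ ^ 2 * (4 * (κ * ‖x‖) ^ 2) := by gcongr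
      _ = 4 * κ ^ 2 * (‖x‖⁻¹ * ‖x‖) ^ 2 := by ring
      _ = _ := by rw [hxx]; ring
  have hD := one_le_diracConst
  calc _ ≤ diracConst * ((κ ^ 2 * ‖x‖⁻¹ + 3 * κ ^ 2 * ‖x‖) + 3 * κ ^ 2 * ‖x‖ + 4 * κ ^ 2) := by
        gcongr
    _ = diracConst * κ ^ 2 * (6 * ‖x‖ + (‖x‖⁻¹ + 4 * 1)) := by ring
    _ ≤ diracConst * κ ^ 2 * (6 * ‖x‖ + (weight x + 4 * weight x)) := by
        gcongr
        · exact inv_norm_le_weight x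
        · exact one_le_weight x
    _ ≤ greenConst * κ ^ 2 * (‖x‖ + weight x) := by
        rw [greenConst]
        have h0 : 0 ≤ diracConst * κ ^ 2 := by positivity
        have h4 := mul_nonneg h0 (weight_nonneg x)
        have h5 := mul_nonneg h0 (norm_nonneg x)
        nlinarith

section

/-! ### Compactness of the threshold operator -/

/-- An operator that is bounded by a finite-rank operator up to small multiples of the norm is
compact. -/
theorem isCompactOperator_of_forall_norm_le {X Y : Type*} [NormedAddCommGroup X] [NormedSpace ℂ X]
    [NormedAddCommGroup Y] [NormedSpace ℂ Y] [CompleteSpace Y] (Θ : X →L[ℂ] Y)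
    (h : ∀ ε : ℝ, 0 < ε → ∃ (ι : Type) (_ : Fintype ι) (Λ : X →L[ℂ] (ι → Spinor)),
      ∀ f, ‖Θ f‖ ≤ ε * ‖f‖ + ‖Λ f‖) : IsCompactOperator Θ := by
  suffices TotallyBounded (Θ '' Metric.closedBall 0 1) by
    change IsCompactOperator (Θ : X →ₗ[ℂ] Y)
    rw [isCompactOperator_iff_isCompact_closure_image_closedBall (Θ : X →ₗ[ℂ] Y) zero_lt_one]
    exact this.closure.isCompact_of_isClosed isClosed_closure
  rw [Metric.totallyBounded_iff]
  intro ε hε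
  -- Points of the unit ball are at distance at most `2`, so the total error stays below `2·ε/4 +
  -- ε/4 < ε`.
  obtain ⟨ι, _, Λ, hΛ⟩ := h (ε / 4) (by positivity)
  have hb : TotallyBounded (Λ '' Metric.closedBall 0 1) := by
    have : Bornology.IsBounded (Λ '' Metric.closedBall 0 1) :=
      Λ.lipschitz.isBounded_image Metric.isBounded_closedBall
    exact this.isCompact_closure.totallyBounded.subset subset_closure
  obtain ⟨t, hts, htf, htc⟩ := Metric.finite_approx_of_totallyBounded hb (ε / 4) (by positivity)
  have hpre : ∀ y ∈ t, ∃ g, g ∈ Metric.closedBall (0 : X) 1 ∧ Λ g = y := fun y hy => hts hy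
  choose! g hg using hpre
  refine ⟨(fun y => Θ (g y)) '' t, htf.image _, ?_⟩
  rintro _ ⟨f, hf, rfl⟩
  have hmem := htc ⟨f, hf, rfl⟩
  simp only [Set.mem_iUnion, Metric.mem_ball] at hmem
  obtain ⟨y, hy, hdist⟩ := hmem
  simp only [Set.mem_iUnion, Metric.mem_ball]
  refine ⟨Θ (g y), ⟨y, hy, rfl⟩, ?_⟩
  obtain ⟨hgy, hgy'⟩ := hg y hy
  rw [dist_eq_norm, ← map_sub]
  have h1 := hΛ (f - g y)
  have h2 : ‖Λ (f - g y)‖ < ε / 4 := by rwa [map_sub, hgy', ← dist_eq_norm]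
  have h3 : ‖f - g y‖ ≤ 2 := by
    have a := norm_sub_le f (g y)
    have b : ‖f‖ ≤ 1 := by simpa using hf
    have c : ‖g y‖ ≤ 1 := by simpa using hgy
    linarith
  nlinarith

/-- Integration against an integrable matrix field, as a functional on `L^∞`. -/
lemma exists_pairing {g : Space → SpinorOp} (hg : Integrable g) :
    ∃ ℓ : LInf →L[ℂ] Spinor, ∀ f : LInf, ℓ f = ∫ y, g y (f y) := by
  have hb : ∀ f : LInf, ∀ᵐ y, ‖g y (f y)‖ ≤ ‖g y‖ * ‖f‖ := fun f => by
    filter_upwards [LInf.ae_norm_le f] with y hy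
    exact ((g y).le_opNorm _).trans (mul_le_mul_of_nonneg_left hy (norm_nonneg _))
  have hi : ∀ f : LInf, Integrable (fun y => g y (f y)) := fun f =>
    (hg.norm.mul_const ‖f‖).mono'
      (aestronglyMeasurable_apply_field hg.aestronglyMeasurable (Lp.aestronglyMeasurable f)) (hb f)
  let ℓ₀ : LInf →ₗ[ℂ] Spinor :=
    { toFun := fun f => ∫ y, g y (f y)
      map_add' := fun f f' => by
        rw [← integral_add (hi f) (hi f')]
        refine integral_congr_ae ?_
        filter_upwards [Lp.coeFn_add f f'] with y hy
        rw [hy, Pi.add_apply, map_add]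
      map_smul' := fun c f => by
        rw [RingHom.id_apply, ← integral_smul]
        refine integral_congr_ae ?_
        filter_upwards [Lp.coeFn_smul c f] with y hy
        rw [hy, Pi.smul_apply, map_smul] }
  refine ⟨ℓ₀.mkContinuous (∫ y, ‖g y‖) fun f => ?_, fun f => rfl⟩
  calc ‖∫ y, g y (f y)‖ ≤ ∫ y, ‖g y (f y)‖ := norm_integral_le_integral_norm _
    _ ≤ ∫ y, ‖g y‖ * ‖f‖ := integral_mono_ae (hi f).norm (hg.norm.mul_const _) (hb f)
    _ = (∫ y, ‖g y‖) * ‖f‖ := integral_mul_const _ _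

/-- The threshold Green function with its singularity cut off at distance `δ`. -/
def greenCutoff (δ : ℝ) (x : Space) : SpinorOp :=
  ((1 / (4 * Real.pi) : ℝ) : ℂ) •
    (-((((max ‖x‖ δ)⁻¹ : ℝ) : ℂ) • ((1 : SpinorOp) + beta))
      - (Complex.I * (((max ‖x‖ δ)⁻¹ ^ 2 * (max ‖x‖ δ)⁻¹ : ℝ) : ℂ)) • alphaDot x)

lemma continuous_alphaDot : Continuous alphaDot := by
  unfold alphaDot
  fun_prop

lemma continuous_greenCutoff {δ : ℝ} (hδ : 0 < δ) : Continuous (greenCutoff δ) := by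
  have h1 : Continuous fun x : Space => (max ‖x‖ δ)⁻¹ :=
    (continuous_norm.max continuous_const).inv₀ fun x => (lt_max_of_lt_right hδ).ne'
  have h2 := continuous_alphaDot
  unfold greenCutoff
  fun_prop

lemma greenCutoff_eq {δ : ℝ} {x : Space} (h : δ ≤ ‖x‖) : greenCutoff δ x = green 1 x := by
  rw [green_one, greenCutoff, max_eq_left h]

lemma norm_greenCutoff_le {δ : ℝ} (hδ : 0 < δ) (x : Space) :
    ‖greenCutoff δ x‖ ≤ diracConst * (2 * (max ‖x‖ δ)⁻¹ + (max ‖x‖ δ)⁻¹ ^ 2) := by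
  set ρ := max ‖x‖ δ with hρ
  have hρ0 : 0 < ρ := lt_max_of_lt_right hδ
  have hxρ : ‖x‖ ≤ ρ := le_max_left _ _
  have h : greenCutoff δ x = ((1 / (4 * Real.pi) : ℝ) : ℂ) •
      (-(((ρ⁻¹ : ℝ) : ℂ) • (1 : SpinorOp)) - ((ρ⁻¹ : ℝ) : ℂ) • beta
        - (((‖x‖⁻¹ : ℝ) : ℂ) * (‖x‖ * (Complex.I * ((ρ⁻¹ ^ 2 * ρ⁻¹ : ℝ) : ℂ)))) • alphaDot x) := by
    rw [greenCutoff, ← hρ]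
    by_cases hx : x = 0
    · subst hx
      have : alphaDot (0 : Space) = 0 := by
        have h0 := norm_alphaDot_le 0
        rwa [norm_zero, mul_zero, norm_le_zero_iff] at h0
      rw [this]; push_cast; module
    · have hx' : ((‖x‖ : ℝ) : ℂ) ≠ 0 := by exact_mod_cast (norm_pos_iff.2 hx).ne'
      have : (((‖x‖⁻¹ : ℝ) : ℂ) * (‖x‖ * (Complex.I * ((ρ⁻¹ ^ 2 * ρ⁻¹ : ℝ) : ℂ)))) =
          Complex.I * ((ρ⁻¹ ^ 2 * ρ⁻¹ : ℝ) : ℂ) := by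
        push_cast; field_simp
      rw [this]; module
  rw [h]
  refine (norm_one_div_four_pi_smul_le _).trans ((norm_three_term_le _ _ _ _).trans ?_)
  have e1 : ‖((ρ⁻¹ : ℝ) : ℂ)‖ = ρ⁻¹ := by
    rw [Complex.norm_real, Real.norm_of_nonneg (by positivity)]
  have e2 : ‖(‖x‖ : ℂ) * (Complex.I * ((ρ⁻¹ ^ 2 * ρ⁻¹ : ℝ) : ℂ))‖ ≤ ρ⁻¹ ^ 2 := by
    rw [norm_mul, norm_mul, Complex.norm_I, one_mul, Complex.norm_real, Complex.norm_real,
      norm_norm, Real.norm_of_nonneg (by positivity)]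
    calc ‖x‖ * (ρ⁻¹ ^ 2 * ρ⁻¹) ≤ ρ * (ρ⁻¹ ^ 2 * ρ⁻¹) := by gcongr
      _ = ρ⁻¹ ^ 2 := by field_simp
  have hD := one_le_diracConst
  rw [e1]
  gcongr
  linarith

/-- The kernels agree outside the ball of radius `δ`. Inside it `δ ≤ 1` makes `‖x‖⁻²` the dominant
power for both; the `3` is `2` from `green 1` plus `1` from the cutoff. -/
lemma norm_green_one_sub_greenCutoff_le {δ : ℝ} (hδ : 0 < δ) (hδ1 : δ ≤ 1) {x : Space}
    (hx : x ≠ 0) : ‖green 1 x - greenCutoff δ x‖ ≤ 3 * greenConst * singularPart δ x := by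
  have hD := one_le_diracConst
  rcases le_or_gt δ ‖x‖ with h | h
  · rw [greenCutoff_eq h, sub_self, norm_zero]
    exact mul_nonneg (by linarith [greenConst_pos]) (singularPart_nonneg _ _)
  · have hx0 : 0 < ‖x‖ := norm_pos_iff.2 hx
    have hs : singularPart δ x = ‖x‖⁻¹ ^ 2 :=
      Set.indicator_of_mem (by simpa using h) _
    have hi : 1 ≤ ‖x‖⁻¹ := (one_le_inv₀ hx0).2 (h.le.trans hδ1)
    have hi2 : ‖x‖⁻¹ ≤ ‖x‖⁻¹ ^ 2 := by nlinarith
    have h1 := isKernel_green_one.bound x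
    have hw : weight x ≤ 2 * ‖x‖⁻¹ ^ 2 := by unfold weight; nlinarith
    have h2 := norm_greenCutoff_le hδ x
    rw [max_eq_right h.le] at h2
    have hδi : δ⁻¹ ≤ ‖x‖⁻¹ := inv_anti₀ hx0 h.le
    have hδ0 : 0 < δ⁻¹ := by positivity
    have hδ2 : δ⁻¹ ^ 2 ≤ ‖x‖⁻¹ ^ 2 := by gcongr
    have h3 : ‖greenCutoff δ x‖ ≤ greenConst * ‖x‖⁻¹ ^ 2 := by
      refine h2.trans ?_
      rw [greenConst]
      calc diracConst * (2 * δ⁻¹ + δ⁻¹ ^ 2) ≤ diracConst * (3 * ‖x‖⁻¹ ^ 2) := by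
            gcongr; linarith
        _ ≤ 20 * diracConst * ‖x‖⁻¹ ^ 2 := by
            have : 0 ≤ diracConst * ‖x‖⁻¹ ^ 2 := by positivity
            linarith
    have h4 := mul_le_mul_of_nonneg_left hw greenConst_pos.le
    rw [hs]
    refine (norm_sub_le _ _).trans ?_
    linarith

lemma isKernel_of_continuous_of_bound {H : Space → SpinorOp} {M : ℝ} (hc : Continuous H)
    (hM : ∀ x, ‖H x‖ ≤ M) : IsKernel H M where
  measurable := hc.stronglyMeasurable
  bound x := (hM x).trans
    (le_mul_of_one_le_right ((norm_nonneg _).trans (hM x)) (one_le_weight x))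

lemma tendsto_greenCutoff {δ : ℝ} (hδ : 0 < δ) :
    Filter.Tendsto (greenCutoff δ) (Filter.comap norm Filter.atTop) (nhds 0) := by
  have hn : Filter.Tendsto (fun x : Space => max ‖x‖ δ) (Filter.comap norm Filter.atTop)
      Filter.atTop :=
    Filter.tendsto_atTop_mono (fun x => le_max_left _ _) Filter.tendsto_comap
  have hi := tendsto_inv_atTop_zero.comp hn
  have := ((hi.const_mul 2).add (hi.pow 2)).const_mul diracConst
  refine squeeze_zero_norm (fun x => norm_greenCutoff_le hδ x) ?_
  simpa using this

lemma ae_sub_ne_zero (x : Space) : ∀ᵐ y : Space, x - y ≠ 0 := by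
  have : ∀ᵐ y : Space, y ≠ x := by
    rw [ae_iff]; simp
  filter_upwards [this] with y hy h
  exact hy (sub_eq_zero.1 h).symm

/-- The threshold Green function is approximated by continuous kernels vanishing at infinity. -/
theorem exists_regular_kernel {ε : ℝ} (hε : 0 < ε) :
    ∃ (H : Space → SpinorOp) (M : ℝ), Continuous H ∧ (∀ x, ‖H x‖ ≤ M) ∧
      Filter.Tendsto H (Filter.comap norm Filter.atTop) (nhds 0) ∧
      ∀ (u : Space → Spinor) (N : ℝ), IsSource u N → ∀ x,
        ‖conv (green 1) u x - conv H u x‖ ≤ ε * N := by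
  have h0 := (tendsto_integral_singularPart.const_mul (3 * greenConst))
  rw [mul_zero] at h0
  -- The cutoff radius is chosen so small that the mass of the singular part, times `3 *
  -- greenConst`, is below `ε`.
  obtain ⟨n, hn⟩ := (h0.eventually_lt_const hε).exists
  set δ : ℝ := 1 / ((n : ℝ) + 1) with hδdef
  have hδ : 0 < δ := by positivity
  have hδ1 : δ ≤ 1 := by
    rw [hδdef, div_le_one (by positivity)]
    linarith [Nat.cast_nonneg (α := ℝ) n]
  have hM : ∀ x, ‖greenCutoff δ x‖ ≤ diracConst * (2 * δ⁻¹ + δ⁻¹ ^ 2) := fun x => by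
    refine (norm_greenCutoff_le hδ x).trans ?_
    have hD := one_le_diracConst
    have : (max ‖x‖ δ)⁻¹ ≤ δ⁻¹ := inv_anti₀ hδ (le_max_right _ _)
    have : 0 ≤ (max ‖x‖ δ)⁻¹ := by positivity
    gcongr
  refine ⟨greenCutoff δ, _, continuous_greenCutoff hδ, hM, tendsto_greenCutoff hδ,
    fun u N hu x => ?_⟩
  have hK := isKernel_of_continuous_of_bound (continuous_greenCutoff hδ) hM
  rw [← isKernel_green_one.conv_sub_kernel hK hu x]
  obtain ⟨hi, hi'⟩ := hu.integrable_singularPart_mul δ x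
  have hG := greenConst_pos
  calc ‖conv (fun z => green 1 z - greenCutoff δ z) u x‖
      ≤ ∫ y, 3 * greenConst * (singularPart δ (x - y) * ‖u y‖) := by
        refine norm_integral_le_of_norm_le (hi.const_mul _) ?_
        filter_upwards [ae_sub_ne_zero x] with y hy
        rw [← mul_assoc]
        exact (ContinuousLinearMap.le_opNorm _ _).trans (mul_le_mul_of_nonneg_right
          (norm_green_one_sub_greenCutoff_le hδ hδ1 hy) (norm_nonneg _))
    _ = 3 * greenConst * ∫ y, singularPart δ (x - y) * ‖u y‖ := integral_const_mul _ _
    _ ≤ 3 * greenConst * ((∫ z, singularPart δ z) * N) := by gcongr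
    _ = (3 * greenConst * ∫ z, singularPart δ z) * N := by ring
    _ ≤ ε * N := mul_le_mul_of_nonneg_right hn.le hu.nonneg

/-! ### Uniform decay and equicontinuity for regular kernels. -/

section RegularKernel

variable {H A : Space → SpinorOp} {M N : ℝ}

/-- No field `f` enters: this integral bounds the action on all `f` at once
(`norm_integral_kernel_apply_le`), so dominated convergence gives estimates uniform on bounded sets
of `L^∞`. -/
lemma tendsto_integral_kernel_mul {l : Filter Space} [l.IsCountablyGenerated]
    (hA : IsSource A N) {D : Space → Space → SpinorOp} (hD : ∀ x, Continuous (D x))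
    (hM : ∀ x y, ‖D x y‖ ≤ M) (hlim : ∀ y, Filter.Tendsto (fun x => D x y) l (nhds 0)) :
    Filter.Tendsto (fun x => ∫ y, ‖D x y‖ * ‖A y‖) l (nhds 0) := by
  have h := tendsto_integral_filter_of_dominated_convergence (l := l) (μ := volume)
    (F := fun x y => ‖D x y‖ * ‖A y‖) (f := fun _ => 0) (fun y => M * ‖A y‖)
    (Filter.Eventually.of_forall fun x =>
      (hD x).norm.aestronglyMeasurable.mul hA.integrable.aestronglyMeasurable.norm)
    (Filter.Eventually.of_forall fun x => Filter.Eventually.of_forall fun y => ?_)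
    (hA.integrable.norm.const_mul M) (Filter.Eventually.of_forall fun y => ?_)
  · simpa using h
  · rw [norm_mul, norm_norm, norm_norm]
    exact mul_le_mul_of_nonneg_right (hM x y) (norm_nonneg _)
  · simpa using ((hlim y).norm.mul_const ‖A y‖)

lemma norm_integral_kernel_apply_le (hA : IsSource A N) {D : Space → SpinorOp}
    (hD : Continuous D) (hM : ∀ y, ‖D y‖ ≤ M) (f : LInf) :
    ‖∫ y, D y (A y (f y))‖ ≤ (∫ y, ‖D y‖ * ‖A y‖) * ‖f‖ := by
  have hi : Integrable (fun y => ‖D y‖ * ‖A y‖) := by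
    refine (hA.integrable.norm.const_mul M).mono'
      (hD.norm.aestronglyMeasurable.mul hA.integrable.aestronglyMeasurable.norm)
      (Filter.Eventually.of_forall fun y => ?_)
    rw [norm_mul, norm_norm, norm_norm]
    exact mul_le_mul_of_nonneg_right (hM y) (norm_nonneg _)
  rw [← integral_mul_const]
  refine norm_integral_le_of_norm_le (hi.mul_const _) ?_
  filter_upwards [LInf.ae_norm_le f] with y hy
  calc ‖D y (A y (f y))‖ ≤ ‖D y‖ * (‖A y‖ * ‖f y‖) :=
        ((D y).le_opNorm _).trans (mul_le_mul_of_nonneg_left ((A y).le_opNorm _) (norm_nonneg _))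
    _ ≤ ‖D y‖ * (‖A y‖ * ‖f‖) := by gcongr
    _ = _ := by ring

/-- Convolution with a regular kernel is small far away, uniformly on bounded sets. -/
lemma exists_radius_conv_le (hA : IsSource A N) (hc : Continuous H) (hM : ∀ x, ‖H x‖ ≤ M)
    (h0 : Filter.Tendsto H (Filter.comap norm Filter.atTop) (nhds 0)) {ε : ℝ} (hε : 0 < ε) :
    ∃ R : ℝ, ∀ x : Space, R ≤ ‖x‖ → ∀ f : LInf,
      ‖conv H (fun y => A y (f y)) x‖ ≤ ε * ‖f‖ := by
  have ht := tendsto_integral_kernel_mul (l := Filter.comap norm Filter.atTop) hA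
    (D := fun x y => H (x - y)) (fun x => hc.comp (continuous_const.sub continuous_id))
    (fun x y => hM _) (fun y => h0.comp ?_)
  · have he := ht.eventually_le_const hε
    rw [Filter.eventually_comap] at he
    obtain ⟨R, hR⟩ := Filter.eventually_atTop.1 he
    refine ⟨R, fun x hx f => ?_⟩
    exact (norm_integral_kernel_apply_le hA (hc.comp (continuous_const.sub continuous_id))
      (fun y => hM _) f).trans (mul_le_mul_of_nonneg_right (hR ‖x‖ hx x rfl) (norm_nonneg _))
  · rw [Filter.tendsto_comap_iff]
    refine Filter.tendsto_atTop_mono (f := fun x : Space => ‖x‖ - ‖y‖)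
      (fun x => norm_sub_norm_le x y) ?_
    exact Filter.tendsto_atTop_add_const_right _ _ Filter.tendsto_comap

/-- On a ball, convolution with a regular kernel is controlled by finitely many values. -/
lemma exists_finset_conv_le (hA : IsSource A N) (hc : Continuous H) (hM : ∀ x, ‖H x‖ ≤ M)
    (R : ℝ) {ε : ℝ} (hε : 0 < ε) :
    ∃ t : Finset Space, ∀ x : Space, ‖x‖ ≤ R → ∃ z ∈ t, ∀ f : LInf,
      ‖conv H (fun y => A y (f y)) x‖ ≤ ε * ‖f‖ + ‖conv H (fun y => A y (f y)) z‖ := by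
  have hK := isKernel_of_continuous_of_bound hc hM
  have ht : ∀ z, Filter.Tendsto (fun x => ∫ y, ‖H (x - y) - H (z - y)‖ * ‖A y‖) (nhds z)
      (nhds 0) := fun z => by
    refine tendsto_integral_kernel_mul hA (D := fun x y => H (x - y) - H (z - y)) (M := M + M)
      (fun x => (hc.comp (continuous_const.sub continuous_id)).sub
        (hc.comp (continuous_const.sub continuous_id)))
      (fun x y => (norm_sub_le _ _).trans (add_le_add (hM _) (hM _))) fun y => ?_
    have : Continuous fun x : Space => H (x - y) - H (z - y) :=
      (hc.comp (continuous_id.sub continuous_const)).sub continuous_const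
    simpa using this.tendsto z
  -- Equicontinuity gives each `z` a neighbourhood on which the convolutions vary by at most `ε‖f‖`;
  -- compactness leaves finitely many of them.
  obtain ⟨t, -, htc⟩ := (isCompact_closedBall (0 : Space) R).elim_nhds_subcover
    (fun z => {x | ∫ y, ‖H (x - y) - H (z - y)‖ * ‖A y‖ ≤ ε})
    (fun z _ => (ht z).eventually_le_const hε)
  refine ⟨t, fun x hx => ?_⟩
  have hx' := htc (by simpa using hx : x ∈ Metric.closedBall (0 : Space) R)
  simp only [Set.mem_iUnion] at hx'
  obtain ⟨z, hz, hxz⟩ := hx'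
  refine ⟨z, hz, fun f => ?_⟩
  have hd : conv H (fun y => A y (f y)) x - conv H (fun y => A y (f y)) z =
      ∫ y, (H (x - y) - H (z - y)) (A y (f y)) := by
    simp only [sub_apply]
    exact (integral_sub (hK.integrable_apply (hA.apply f) x)
      (hK.integrable_apply (hA.apply f) z)).symm
  have hle := norm_integral_kernel_apply_le hA (D := fun y => H (x - y) - H (z - y)) (M := M + M)
    ((hc.comp (continuous_const.sub continuous_id)).sub
        (hc.comp (continuous_const.sub continuous_id)))
    (fun y => (norm_sub_le _ _).trans (add_le_add (hM _) (hM _))) f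
  rw [← hd] at hle
  have := norm_le_norm_sub_add (conv H (fun y => A y (f y)) x) (conv H (fun y => A y (f y)) z)
  have h5 := mul_le_mul_of_nonneg_right hxz (norm_nonneg f)
  linarith

end RegularKernel

variable {A : Space → SpinorOp} {N : ℝ} {T₁ : LInf →L[ℂ] LInf}

/-- The threshold operator is compact on `L^∞`. -/
theorem isCompactOperator_threshold (hA : IsSource A N)
    (hT : ∀ f : LInf, ∀ᵐ x, T₁ f x = conv (green 1) (fun y => A y (f y)) x) :
    IsCompactOperator T₁ := by
  refine isCompactOperator_of_forall_norm_le T₁ fun ε hε => ?_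
  have hN := hA.nonneg
  -- Half of `ε` pays for regularizing the kernel, the other half for the finite set of sample
  -- points. The `+ 1` avoids division by zero.
  obtain ⟨H, M, hc, hM, h0, happ⟩ := exists_regular_kernel
    (by positivity : 0 < ε / 2 / (N + 1))
  have hK := isKernel_of_continuous_of_bound hc hM
  obtain ⟨R, hR⟩ := exists_radius_conv_le hA hc hM h0 (half_pos hε)
  obtain ⟨t, ht⟩ := exists_finset_conv_le hA hc hM R (half_pos hε)
  have hpair : ∀ z : Space, ∃ ℓ : LInf →L[ℂ] Spinor, ∀ f : LInf,
      ℓ f = conv H (fun y => A y (f y)) z := fun z => by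
    have hm : Continuous fun y : Space => H (z - y) :=
      hc.comp (continuous_const.sub continuous_id)
    have hg : Integrable (fun y => H (z - y) ∘L A y) := by
      refine (hA.integrable.norm.const_mul M).mono' ?_ (Filter.Eventually.of_forall fun y => ?_)
      · exact (ContinuousLinearMap.compL ℂ Spinor Spinor Spinor).aestronglyMeasurable_comp₂
          hm.aestronglyMeasurable hA.integrable.aestronglyMeasurable
      · exact (ContinuousLinearMap.opNorm_comp_le _ _).trans
          (mul_le_mul_of_nonneg_right (hM _) (norm_nonneg _))
    obtain ⟨ℓ, hℓ⟩ := exists_pairing hg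
    exact ⟨ℓ, fun f => hℓ f⟩
  choose ℓ hℓ using hpair
  refine ⟨t, inferInstance, ContinuousLinearMap.pi fun z : t => ℓ z, fun f => ?_⟩
  refine LInf.norm_le_of_ae_bound (by positivity) ?_
  filter_upwards [hT f] with x hx
  rw [hx]
  have h1 := happ _ _ (hA.apply f) x
  have h2 : ε / 2 / (N + 1) * (‖f‖ * N) ≤ ε / 2 * ‖f‖ := by
    have : ε / 2 / (N + 1) * (‖f‖ * N) = ε / 2 * ‖f‖ * (N / (N + 1)) := by ring
    rw [this]
    refine mul_le_of_le_one_right (by positivity) ?_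
    rw [div_le_one (by positivity)]; linarith
  have h3 := norm_le_norm_sub_add (conv (green 1) (fun y => A y (f y)) x)
    (conv H (fun y => A y (f y)) x)
  set Λ := ContinuousLinearMap.pi fun z : t => ℓ z with hΛ
  have h4 : ‖conv H (fun y => A y (f y)) x‖ ≤ ε / 2 * ‖f‖ + ‖Λ f‖ := by
    rcases le_total R ‖x‖ with hxR | hxR
    · exact (hR x hxR f).trans (le_add_of_nonneg_right (norm_nonneg _))
    · obtain ⟨z, hz, hzf⟩ := ht x hxR
      refine (hzf f).trans (add_le_add_right ?_ _)
      rw [← hℓ]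
      exact norm_le_pi_norm (Λ f) ⟨z, hz⟩
  linarith

/-- The threshold operator maps `L^∞` into the functions vanishing at infinity. -/
theorem vanishesAtInfinity_threshold (hA : IsSource A N)
    (hT : ∀ f : LInf, ∀ᵐ x, T₁ f x = conv (green 1) (fun y => A y (f y)) x) (f : LInf) :
    VanishesAtInfinity (T₁ f) := by
  intro ε hε
  have hN := hA.nonneg
  obtain ⟨H, M, hc, hM, h0, happ⟩ := exists_regular_kernel
    (by positivity : 0 < ε / 3 / (‖f‖ * N + 1))
  obtain ⟨R, hR⟩ := exists_radius_conv_le hA hc hM h0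
    (by positivity : 0 < ε / 3 / (‖f‖ + 1))
  refine ⟨R, ?_⟩
  filter_upwards [hT f] with x hx hxR
  rw [hx]
  have h1 := happ _ _ (hA.apply f) x
  have h2 : ε / 3 / (‖f‖ * N + 1) * (‖f‖ * N) ≤ ε / 3 := by
    rw [div_mul_eq_mul_div]
    exact div_le_of_le_mul₀ (by positivity) (by positivity) (by gcongr; linarith)
  have h4 : ε / 3 / (‖f‖ + 1) * ‖f‖ ≤ ε / 3 := by
    rw [div_mul_eq_mul_div]
    exact div_le_of_le_mul₀ (by positivity) (by positivity) (by gcongr; linarith)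
  have h5 := hR x hxR.le f
  have h3 := norm_le_norm_sub_add (conv (green 1) (fun y => A y (f y)) x)
    (conv H (fun y => A y (f y)) x)
  linarith

/-- The zero space is the kernel of `1 - T^A_1`. -/
theorem mem_zeroSpace_iff (hA : IsSource A N)
    (hT : ∀ f : LInf, ∀ᵐ x, T₁ f x = conv (green 1) (fun y => A y (f y)) x) (Φ : LInf) :
    Φ ∈ zeroSpace A ↔ T₁ Φ = Φ := by
  constructor
  · rintro ⟨-, h⟩
    refine Lp.ext ?_
    filter_upwards [h, hT Φ] with x h1 h2
    rw [h2, h1]; rfl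
  · intro h
    refine ⟨?_, ?_⟩
    · have := vanishesAtInfinity_threshold hA hT Φ
      rwa [h] at this
    · have := hT Φ
      rw [h] at this
      exact this

end

/-! ### The reduction to the kernel of `1 - T` -/

section Reduction

variable {X : Type*} [NormedAddCommGroup X] [NormedSpace ℂ X]

/-- The fixed space of a compact operator is finite dimensional. -/
theorem finiteDimensional_fixed {T : X →L[ℂ] X} (hT : IsCompactOperator T) :
    FiniteDimensional ℂ (LinearMap.ker ((1 - T : X →L[ℂ] X) : X →ₗ[ℂ] X)) := by
  set W := LinearMap.ker ((1 - T : X →L[ℂ] X) : X →ₗ[ℂ] X) with hW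
  have hfix : ∀ v ∈ W, T v = v := fun v hv => by
    have : v - T v = 0 := hv
    exact (sub_eq_zero.1 this).symm
  have hV : ∀ v ∈ W, (T : X →ₗ[ℂ] X) v ∈ W := fun v hv => by
    have : (T : X →ₗ[ℂ] X) v = v := hfix v hv
    rwa [this]
  have hcl : IsClosed (W : Set X) := ContinuousLinearMap.isClosed_ker (1 - T : X →L[ℂ] X)
  have hc := IsCompactOperator.restrict (f := (T : X →ₗ[ℂ] X)) hT hV hcl
  refine FiniteDimensional.of_isCompactOperator_id (𝕜 := ℂ) (E := W) ?_
  have hid : ((T : X →ₗ[ℂ] X).restrict hV : W → W) = id := by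
    funext v
    exact Subtype.ext (hfix v v.2)
  rwa [hid] at hc

/-- Fredholm alternative for perturbations of the identity. -/
theorem isUnit_one_sub_of_injective [CompleteSpace X] {T : X →L[ℂ] X} (hT : IsCompactOperator T)
    (hinj : ∀ f, T f = f → f = 0) : IsUnit (1 - T) := by
  rcases hT.hasEigenvalue_or_mem_resolventSet (one_ne_zero (α := ℂ)) with h | h
  · obtain ⟨v, hv⟩ := h.exists_hasEigenvector
    have h1 : T v = v := by simpa using hv.apply_eq_smul
    exact absurd (hinj v h1) hv.2
  · have := spectrum.mem_resolventSet_iff.1 h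
    simpa using this

/-- Spectral projection onto the fixed space of `T` along the annihilator of a nondegenerate form. -/
theorem exists_projection {T : X →L[ℂ] X} (hT : IsCompactOperator T) (a : X → X →L[ℂ] ℂ)
    (hsymm : ∀ Φ Ψ, a Φ Ψ = 0 → a Ψ Φ = 0)
    (hnd : ∀ Φ, T Φ = Φ → (∀ Ψ, T Ψ = Ψ → a Φ Ψ = 0) → Φ = 0)
    (hinv : ∀ Φ, T Φ = Φ → ∀ f, a Φ (T f) = a Φ f) :
    ∃ P : X →L[ℂ] X, IsCompactOperator P ∧ (∀ f, T (P f) = P f) ∧ (∀ f, T f = f → P f = f) ∧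
      ∀ f, P (T f) = P f := by
  set W := LinearMap.ker ((1 - T : X →L[ℂ] X) : X →ₗ[ℂ] X) with hW
  have hfix : ∀ v, v ∈ W ↔ T v = v := fun v => by
    rw [hW, LinearMap.mem_ker]
    change v - T v = 0 ↔ _
    rw [sub_eq_zero, eq_comm]
  have : FiniteDimensional ℂ W := finiteDimensional_fixed hT
  let b := Module.finBasis ℂ W
  let Θ : X →L[ℂ] (Fin (Module.finrank ℂ W) → ℂ) := ContinuousLinearMap.pi fun i => a (b i : X)
  let Θ' : W →ₗ[ℂ] (Fin (Module.finrank ℂ W) → ℂ) := (Θ : X →ₗ[ℂ] _) ∘ₗ W.subtype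
  -- A fixed vector `w` killed by all `a (b i)` satisfies `a w (b i) = 0` by `hsymm`. Linearity of
  -- `a w` extends this to the whole fixed space, and nondegeneracy gives `w = 0`. Equal dimensions
  -- then make `Θ'` invertible, and the projection is its inverse after `Θ`.
  have hinj : Function.Injective Θ' := by
    rw [← LinearMap.ker_eq_bot, LinearMap.ker_eq_bot']
    intro w hw
    have hw' : ∀ i, a (b i : X) w = 0 := fun i => congrFun hw i
    refine Subtype.ext (hnd w ((hfix _).1 w.2) fun Ψ hΨ => ?_)
    have hker : (⊤ : Submodule ℂ W) ≤ LinearMap.ker ((a w : X →ₗ[ℂ] ℂ) ∘ₗ W.subtype) := by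
      rw [← b.span_eq, Submodule.span_le]
      rintro _ ⟨i, rfl⟩
      exact hsymm _ _ (hw' i)
    exact hker (Submodule.mem_top (x := ⟨Ψ, (hfix Ψ).2 hΨ⟩))
  let e : W ≃ₗ[ℂ] (Fin (Module.finrank ℂ W) → ℂ) :=
    LinearEquiv.ofInjectiveOfFinrankEq Θ' hinj (by simp)
  have he : ∀ w : W, e w = Θ w := fun w => rfl
  let Q : (Fin (Module.finrank ℂ W) → ℂ) →L[ℂ] X :=
    LinearMap.toContinuousLinearMap (W.subtype ∘ₗ (e.symm : _ →ₗ[ℂ] W))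
  have hQ : ∀ v, Q v = (e.symm v : X) := fun v => rfl
  refine ⟨Q ∘L Θ, ?_, fun f => ?_, fun f hf => ?_, fun f => ?_⟩
  · exact (isCompactOperator_of_locallyCompactSpace_dom Θ).clm_comp Q
  · exact (hfix _).1 (e.symm (Θ f)).2
  · have : e.symm (Θ f) = ⟨f, (hfix f).2 hf⟩ := by
      rw [LinearEquiv.symm_apply_eq, he]
    change Q (Θ f) = f
    rw [hQ, this]
  · have : Θ (T f) = Θ f := funext fun i => hinv _ ((hfix _).1 (b i).2) f
    change Q (Θ (T f)) = Q (Θ f)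
    rw [this]

/-- Perturbation of `1 - T` near a nontrivial fixed space: solvability follows from uniqueness, and
every vector is split into a fixed vector of `T` and a controlled remainder. -/
theorem exists_reduction [CompleteSpace X] {T : X →L[ℂ] X} (hT : IsCompactOperator T)
    (a : X → X →L[ℂ] ℂ)
    (hsymm : ∀ Φ Ψ, a Φ Ψ = 0 → a Ψ Φ = 0)
    (hnd : ∀ Φ, T Φ = Φ → (∀ Ψ, T Ψ = Ψ → a Φ Ψ = 0) → Φ = 0)
    (hinv : ∀ Φ, T Φ = Φ → ∀ f, a Φ (T f) = a Φ f) :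
    ∃ c δ : ℝ, 0 < c ∧ 0 < δ ∧ ∀ S : X →L[ℂ] X, ‖S‖ ≤ δ →
      ((∀ φ, φ - T φ - S φ = 0 → φ = 0) → ∀ χ, ∃ φ, φ - T φ - S φ = χ) ∧
      ∀ φ, ∃ Φ, T Φ = Φ ∧ ‖φ - Φ‖ ≤ c * (‖φ - T φ - S φ‖ + ‖S‖ * ‖Φ‖) := by
  obtain ⟨P, hPc, hTP, hPfix, hPT⟩ := exists_projection hT a hsymm hnd hinv
  -- If `Tf - Pf = f`, applying `P` gives `Pf = 0` since `PT = P = P²`; then `f` is fixed by `T` and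
  -- equals `Pf = 0`.
  have hunit : IsUnit (1 - (T - P)) := by
    refine isUnit_one_sub_of_injective (hT.sub hPc) fun f hf => ?_
    have hf' : T f - P f = f := hf
    have h1 : P f = 0 := by
      have := congrArg P hf'
      rw [map_sub, hPT, hPfix (P f) (hTP f), sub_self] at this
      exact this.symm
    rw [h1, sub_zero] at hf'
    rw [← hPfix f hf', h1]
  obtain ⟨L, hL⟩ := hunit
  set J : X →L[ℂ] X := ((L⁻¹ : (X →L[ℂ] X)ˣ) : X →L[ℂ] X) with hJ
  have hJL : ∀ f, J (f - T f + P f) = f := fun f => by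
    have h1 : J * (L : X →L[ℂ] X) = 1 := L.inv_mul
    have h2 : (L : X →L[ℂ] X) f = f - T f + P f := by
      rw [hL]; change f - (T f - P f) = _; abel
    rw [← h2]
    exact DFunLike.congr_fun h1 f
  have hopen : ∀ᶠ Y in nhds (L : X →L[ℂ] X), IsUnit Y :=
    (Units.isOpen (R := X →L[ℂ] X)).mem_nhds L.isUnit
  obtain ⟨δ₁, hδ₁, hball⟩ := Metric.eventually_nhds_iff.1 hopen
  set j := ‖J‖ + 1 with hj
  have hj0 : 0 < j := by positivity
  -- The first bound on `S` keeps `1 - T + P - S` invertible; the second makes `j‖S‖ ≤ 1/2`, so that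
  -- `S m` is absorbed and `j` doubles.
  refine ⟨2 * j, min (δ₁ / 2) (1 / (2 * j)), by positivity, by positivity, fun S hS => ⟨?_, ?_⟩⟩
  · intro hinj χ
    have hU : IsUnit ((L : X →L[ℂ] X) - S) := by
      refine hball ?_
      rw [dist_eq_norm, sub_sub_cancel_left, norm_neg]
      have := hS.trans (min_le_left _ _)
      linarith
    obtain ⟨U, hU⟩ := hU
    set R : X →L[ℂ] X := ((U⁻¹ : (X →L[ℂ] X)ˣ) : X →L[ℂ] X) with hR
    have hUf : ∀ f, (U : X →L[ℂ] X) f = f - T f - S f + P f := fun f => by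
      rw [hU, hL]; change f - (T f - P f) - S f = _; abel
    have hUR : ∀ f, (U : X →L[ℂ] X) (R f) = f := fun f => DFunLike.congr_fun U.mul_inv f
    -- Since `1 - T - S = U (1 - R P)` with `R P` compact, injectivity already gives surjectivity.
    have hcomp : IsUnit (1 - R ∘L P) := by
      refine isUnit_one_sub_of_injective (hPc.clm_comp R) fun f hf => hinj f ?_
      have hf' : R (P f) = f := hf
      have h1 := hUR (P f)
      rw [hf', hUf] at h1
      exact add_eq_right.1 h1
    rw [ContinuousLinearMap.isUnit_iff_bijective] at hcomp
    obtain ⟨φ, hφ⟩ := hcomp.2 (R χ)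
    refine ⟨φ, ?_⟩
    have h1 : φ - R (P φ) = R χ := hφ
    have h2 := congrArg (U : X →L[ℂ] X) h1
    rw [map_sub, hUR, hUR, hUf, add_sub_cancel_right] at h2
    exact h2
  · intro φ
    refine ⟨P φ, hTP φ, ?_⟩
    set m := φ - P φ with hm
    have hPm : P m = 0 := by rw [hm, map_sub, hPfix _ (hTP φ), sub_self]
    have hTm : m - T m = φ - T φ := by rw [hm, map_sub, hTP]; abel
    -- Because `P m = 0`, the operator `1 - T + P` acts on `m` as `1 - T`, which sends `m` to `φ - T
    -- φ`.
    have h1 : m = J ((φ - T φ - S φ) + (S m + S (P φ))) := by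
      conv_lhs => rw [← hJL m]
      rw [hPm, add_zero, hTm, ← map_add, hm, sub_add_cancel, sub_add_cancel]
    have h2 : ‖m‖ ≤ j * (‖φ - T φ - S φ‖ + (‖S‖ * ‖m‖ + ‖S‖ * ‖P φ‖)) := by
      conv_lhs => rw [h1]
      refine (J.le_opNorm _).trans ?_
      refine mul_le_mul (by linarith) ?_ (norm_nonneg _) hj0.le
      refine (norm_add_le _ _).trans (add_le_add_right ((norm_add_le _ _).trans ?_) _)
      exact add_le_add (S.le_opNorm _) (S.le_opNorm _)
    have h3 : j * ‖S‖ ≤ 1 / 2 := by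
      have := hS.trans (min_le_right _ _)
      rw [le_div_iff₀ (by positivity)] at this
      linarith
    have h4 := mul_le_mul_of_nonneg_right h3 (norm_nonneg m)
    nlinarith

end Reduction

/-! ### Sesquilinear forms of potentials -/

section Form

variable {V A : Space → SpinorOp} {N N' : ℝ}

lemma ae_norm_inner_apply_le (V : Space → SpinorOp) (f g : LInf) :
    ∀ᵐ x, ‖(inner ℂ (f x) (V x (g x)) : ℂ)‖ ≤ ‖f‖ * ‖g‖ * ‖V x‖ := by
  filter_upwards [LInf.ae_norm_le f, LInf.ae_norm_le g] with x hf hg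
  calc ‖(inner ℂ (f x) (V x (g x)) : ℂ)‖ ≤ ‖f x‖ * ‖V x (g x)‖ := norm_inner_le_norm _ _
    _ ≤ ‖f x‖ * (‖V x‖ * ‖g x‖) := by gcongr; exact (V x).le_opNorm _
    _ ≤ ‖f‖ * (‖V x‖ * ‖g‖) := by gcongr
    _ = _ := by ring

lemma integrable_form (hV : IsSource V N) (f g : LInf) :
    Integrable (fun x => (inner ℂ (f x) (V x (g x)) : ℂ)) :=
  (hV.integrable.norm.const_mul (‖f‖ * ‖g‖)).mono'
    ((Lp.aestronglyMeasurable f).inner (hV.apply g).integrable.aestronglyMeasurable)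
    (ae_norm_inner_apply_le V f g)

lemma norm_form_le (hV : IsSource V N) (f g : LInf) : ‖form f V g‖ ≤ N * ‖f‖ * ‖g‖ := by
  calc ‖form f V g‖ ≤ ∫ x, ‖f‖ * ‖g‖ * ‖V x‖ :=
        norm_integral_le_of_norm_le (hV.integrable.norm.const_mul _) (ae_norm_inner_apply_le V f g)
    _ = ‖f‖ * ‖g‖ * ∫ x, ‖V x‖ := integral_const_mul _ _
    _ ≤ ‖f‖ * ‖g‖ * N := by gcongr; exact hV.integral_le
    _ = _ := by ring

lemma exists_formFunctional (hV : IsSource V N) (f : LInf) :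
    ∃ ℓ : LInf →L[ℂ] ℂ, ∀ g : LInf, ℓ g = form f V g := by
  let ℓ₀ : LInf →ₗ[ℂ] ℂ :=
    { toFun := fun g => form f V g
      map_add' := fun g g' => by
        unfold form
        rw [← integral_add (integrable_form hV f g) (integrable_form hV f g')]
        refine integral_congr_ae ?_
        filter_upwards [Lp.coeFn_add g g'] with x hx
        rw [hx, Pi.add_apply, map_add, inner_add_right]
      map_smul' := fun c g => by
        unfold form
        rw [RingHom.id_apply, ← integral_smul]
        refine integral_congr_ae ?_
        filter_upwards [Lp.coeFn_smul c g] with x hx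
        rw [hx, Pi.smul_apply, map_smul, inner_smul_right, smul_eq_mul] }
  exact ⟨ℓ₀.mkContinuous (N * ‖f‖) fun g => norm_form_le hV f g, fun g => rfl⟩

lemma inner_apply_of_isSelfAdjoint {M : SpinorOp} (hM : IsSelfAdjoint M) (v w : Spinor) :
    (inner ℂ v (M w) : ℂ) = inner ℂ (M v) w := by
  rw [← ContinuousLinearMap.adjoint_inner_left, ← ContinuousLinearMap.star_eq_adjoint, hM.star_eq]

lemma form_eq_integral_inner_left (hV : ∀ᵐ x : Space, IsSelfAdjoint (V x))
    (f g : Space → Spinor) : form f V g = ∫ x, inner ℂ (V x (f x)) (g x) := by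
  refine integral_congr_ae ?_
  filter_upwards [hV] with x hx using inner_apply_of_isSelfAdjoint hx _ _

lemma form_conj_symm (hV : ∀ᵐ x : Space, IsSelfAdjoint (V x)) (f g : Space → Spinor) :
    (starRingEnd ℂ) (form f V g) = form g V f := by
  rw [form_eq_integral_inner_left hV g f, form, ← integral_conj]
  refine integral_congr_ae (Filter.Eventually.of_forall fun x => ?_)
  exact inner_conj_symm _ _

/-- Reality of the form of `B` keeps it from cancelling the imaginary first-order term in the wave
number. -/
lemma form_self_im (hV : ∀ᵐ x : Space, IsSelfAdjoint (V x)) (f : Space → Spinor) :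
    (form f V f).im = 0 :=
  Complex.conj_eq_iff_im.1 (form_conj_symm hV f f)

/-- The threshold Green function is a symmetric kernel. -/
theorem integral_inner_conv_green_one {p u : Space → Spinor} (hp : IsSource p N)
    (hu : IsSource u N') :
    ∫ x, (inner ℂ (p x) (conv (green 1) u x) : ℂ) = ∫ y, inner ℂ (conv (green 1) p y) (u y) := by
  have hK := isKernel_green_one
  have hmeas : AEStronglyMeasurable
      (fun q : Space × Space => (inner ℂ (p q.1) (green 1 (q.1 - q.2) (u q.2)) : ℂ))
      ((volume : Measure Space).prod volume) :=
    (hp.integrable.aestronglyMeasurable.comp_fst).inner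
      (hK.aestronglyMeasurable_prod hu.integrable.aestronglyMeasurable)
  have hint : Integrable
      (fun q : Space × Space => (inner ℂ (p q.1) (green 1 (q.1 - q.2) (u q.2)) : ℂ))
      ((volume : Measure Space).prod volume) := by
    rw [integrable_prod_iff hmeas]
    have hin : ∀ x, Integrable (fun y => (inner ℂ (p x) (green 1 (x - y) (u y)) : ℂ)) :=
      fun x => (hK.integrable_apply hu x).const_inner (p x)
    refine ⟨Filter.Eventually.of_forall hin, ?_⟩
    refine (hp.integrable.norm.mul_const (greenConst * weightConst * N')).mono'
      hmeas.norm.integral_prod_right' (Filter.Eventually.of_forall fun x => ?_)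
    rw [Real.norm_of_nonneg (integral_nonneg fun _ => norm_nonneg _)]
    calc ∫ y, ‖(inner ℂ (p x) (green 1 (x - y) (u y)) : ℂ)‖
        ≤ ∫ y, ‖p x‖ * ‖green 1 (x - y) (u y)‖ :=
          integral_mono (hin x).norm ((hK.integrable_apply hu x).norm.const_mul _)
            fun y => norm_inner_le_norm _ _
      _ = ‖p x‖ * ∫ y, ‖green 1 (x - y) (u y)‖ := integral_const_mul _ _
      _ ≤ _ := mul_le_mul_of_nonneg_left (hK.integral_norm_le hu x) (norm_nonneg _)
  calc ∫ x, (inner ℂ (p x) (conv (green 1) u x) : ℂ)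
      = ∫ x, ∫ y, (inner ℂ (p x) (green 1 (x - y) (u y)) : ℂ) := by
        refine integral_congr_ae (Filter.Eventually.of_forall fun x => ?_)
        exact (integral_inner (hK.integrable_apply hu x) (p x)).symm
    _ = ∫ y, ∫ x, (inner ℂ (p x) (green 1 (x - y) (u y)) : ℂ) := integral_integral_swap hint
    _ = ∫ y, inner ℂ (conv (green 1) p y) (u y) := by
        refine integral_congr_ae (Filter.Eventually.of_forall fun y => ?_)
        change ∫ x, (inner ℂ (p x) (green 1 (x - y) (u y)) : ℂ) = inner ℂ (conv (green 1) p y) (u y)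
        rw [← inner_conj_symm, conv, ← integral_inner (hK.integrable_apply hp y), ← integral_conj]
        refine integral_congr_ae (Filter.Eventually.of_forall fun x => ?_)
        change (inner ℂ (p x) (green 1 (x - y) (u y)) : ℂ) =
          (starRingEnd ℂ) (inner ℂ (u y) (green 1 (y - x) (p x)))
        rw [inner_conj_symm, ← neg_sub x y, ← adjoint_green_one,
          ContinuousLinearMap.adjoint_inner_left]

/-- For a threshold state `Φ`, `⟨Φ, A, T^V_1 f⟩ = ⟨Φ, V, f⟩`. -/
theorem form_threshold (hA : IsSource A N) (hsa : ∀ᵐ x, IsSelfAdjoint (A x))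
    (hV : IsSource V N') {Φ f g : LInf}
    (hΦ : ∀ᵐ x, Φ x = conv (green 1) (fun y => A y (Φ y)) x)
    (hg : ∀ᵐ x, g x = conv (green 1) (fun y => V y (f y)) x) :
    form Φ A g = form Φ V f := by
  -- With `A` moved onto `Φ`, the symmetric kernel acts on `AΦ` and reproduces `Φ`.
  rw [form_eq_integral_inner_left hsa]
  calc ∫ x, (inner ℂ (A x (Φ x)) (g x) : ℂ)
      = ∫ x, inner ℂ (A x (Φ x)) (conv (green 1) (fun y => V y (f y)) x) := by
        refine integral_congr_ae ?_
        filter_upwards [hg] with x hx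
        rw [hx]
    _ = ∫ y, inner ℂ (conv (green 1) (fun y => A y (Φ y)) y) (V y (f y)) :=
        integral_inner_conv_green_one (hA.apply Φ) (hV.apply f)
    _ = form Φ V f := by
        refine integral_congr_ae ?_
        filter_upwards [hΦ] with x hx
        rw [hx]

end Form

section

/-! ### Weighted potentials -/

section Weighted

variable {A : Space → SpinorOp} {N : ℝ}

/-- `A` remains a source after multiplication by `(1 + |x|)²`. -/
abbrev IsWeightedSource (A : Space → SpinorOp) (N : ℝ) : Prop :=
  IsSource (fun x => (((1 + ‖x‖) ^ 2 : ℝ) : ℂ) • A x) N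

lemma norm_weighted (x : Space) (M : SpinorOp) :
    ‖(((1 + ‖x‖) ^ 2 : ℝ) : ℂ) • M‖ = (1 + ‖x‖) ^ 2 * ‖M‖ := by
  rw [norm_smul, Complex.norm_real, Real.norm_of_nonneg (by positivity)]

lemma IsSource.of_weighted (hA : IsWeightedSource A N) (hm : AEStronglyMeasurable A) :
    IsSource A N := by
  have := hA.mono zero_le_one hm (Filter.Eventually.of_forall fun x => ?_)
  · rwa [one_mul] at this
  · rw [one_mul, norm_weighted]
    refine le_mul_of_one_le_left (norm_nonneg _) ?_
    nlinarith [norm_nonneg x]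

/-- The product of a weighted potential with a bounded field. -/
lemma IsSource.weighted_apply (hA : IsWeightedSource A N) (hm : AEStronglyMeasurable A)
    (Φ : LInf) : IsSource (fun y => (1 + ‖y‖) ^ 2 * ‖A y (Φ y)‖) (‖Φ‖ * N) := by
  have h := hA.apply Φ
  have hmeas : AEStronglyMeasurable (fun y : Space => (1 + ‖y‖) ^ 2 * ‖A y (Φ y)‖) :=
    (Continuous.aestronglyMeasurable (by fun_prop)).mul
      (aestronglyMeasurable_apply_field hm (Lp.aestronglyMeasurable Φ)).norm
  have := h.mono zero_le_one hmeas (Filter.Eventually.of_forall fun y => ?_)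
  · rwa [one_mul] at this
  · rw [one_mul, smul_apply, norm_smul, Complex.norm_real,
      Real.norm_of_nonneg (by positivity), Real.norm_of_nonneg (by positivity)]

end Weighted

/-! ### Threshold resonances -/

/-- At infinity `|x-y|⁻¹` is replaced by `|x|⁻¹`. The inequality `|x| ≤ |x-y| + |y|` shifts the two
powers of `|x|` onto the weight and onto `(1+|y|)²`, which is the decay of `A` assumed in (b). -/
lemma norm_green_one_add_le {x y : Space} (hx : x ≠ 0) (hz : x - y ≠ 0) :
    ‖x‖ ^ 2 * ‖green 1 (x - y) + (((1 / (4 * Real.pi) : ℝ) : ℂ) * ((‖x‖⁻¹ : ℝ) : ℂ)) •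
      ((1 : SpinorOp) + beta)‖ ≤ 4 * diracConst * (weight (x - y) * (1 + ‖y‖) ^ 2) := by
  set z := x - y with hzdef
  have hx0 : 0 < ‖x‖ := norm_pos_iff.2 hx
  have hz0 : 0 < ‖z‖ := norm_pos_iff.2 hz
  have hD := one_le_diracConst
  have h : green 1 z + (((1 / (4 * Real.pi) : ℝ) : ℂ) * ((‖x‖⁻¹ : ℝ) : ℂ)) •
      ((1 : SpinorOp) + beta) = ((1 / (4 * Real.pi) : ℝ) : ℂ) •
      (-(((‖z‖⁻¹ - ‖x‖⁻¹ : ℝ) : ℂ) • (1 : SpinorOp)) - ((‖z‖⁻¹ - ‖x‖⁻¹ : ℝ) : ℂ) • beta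
        - (((‖z‖⁻¹ : ℝ) : ℂ) * (Complex.I * ((‖z‖⁻¹ ^ 2 : ℝ) : ℂ))) • alphaDot z) := by
    rw [green_one]; push_cast; module
  have h1 : ‖green 1 z + (((1 / (4 * Real.pi) : ℝ) : ℂ) * ((‖x‖⁻¹ : ℝ) : ℂ)) •
      ((1 : SpinorOp) + beta)‖ ≤ diracConst * (2 * |‖z‖⁻¹ - ‖x‖⁻¹| + ‖z‖⁻¹ ^ 2) := by
    rw [h]
    refine (norm_one_div_four_pi_smul_le _).trans ((norm_three_term_le _ _ _ _).trans
      (le_of_eq ?_))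
    have e2 : ‖Complex.I * ((‖z‖⁻¹ ^ 2 : ℝ) : ℂ)‖ = ‖z‖⁻¹ ^ 2 := by simp
    rw [e2, Complex.norm_real, Real.norm_eq_abs]
    ring
  have hy : |‖x‖ - ‖z‖| ≤ ‖y‖ := by
    have := abs_norm_sub_norm_le x z
    rwa [hzdef, sub_sub_cancel] at this
  have hxy : ‖x‖ ≤ ‖z‖ + ‖y‖ := by
    have := (abs_le.1 hy).2; linarith
  have hzz : ‖z‖⁻¹ * ‖z‖ = 1 := inv_mul_cancel₀ hz0.ne'
  have hi0 : 0 ≤ ‖z‖⁻¹ := by positivity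
  have hy0 := norm_nonneg y
  have hw1 := one_le_weight z
  have hw2 := inv_norm_le_weight z
  have hw3 := inv_norm_sq_le_weight z
  have h2 : ‖x‖ ^ 2 * |‖z‖⁻¹ - ‖x‖⁻¹| ≤ weight z * (1 + ‖y‖) ^ 2 := by
    have : ‖z‖⁻¹ - ‖x‖⁻¹ = ‖z‖⁻¹ * ‖x‖⁻¹ * (‖x‖ - ‖z‖) := by field_simp
    rw [this, abs_mul, abs_of_nonneg (by positivity)]
    calc ‖x‖ ^ 2 * (‖z‖⁻¹ * ‖x‖⁻¹ * |‖x‖ - ‖z‖|) = ‖x‖ * ‖z‖⁻¹ * |‖x‖ - ‖z‖| := by field_simp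
      _ ≤ (‖z‖ + ‖y‖) * ‖z‖⁻¹ * ‖y‖ := by gcongr
      _ = ‖y‖ * (‖z‖⁻¹ * ‖z‖) + ‖y‖ ^ 2 * ‖z‖⁻¹ := by ring
      _ ≤ ‖y‖ * weight z + ‖y‖ ^ 2 * weight z := by
          rw [hzz]; gcongr
      _ ≤ weight z * (1 + ‖y‖) ^ 2 := by nlinarith [mul_nonneg hy0 (weight_nonneg z)]
  have h3 : ‖x‖ ^ 2 * ‖z‖⁻¹ ^ 2 ≤ 2 * (weight z * (1 + ‖y‖) ^ 2) := by
    calc ‖x‖ ^ 2 * ‖z‖⁻¹ ^ 2 ≤ (‖z‖ + ‖y‖) ^ 2 * ‖z‖⁻¹ ^ 2 := by gcongr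
      _ ≤ (2 * ‖z‖ ^ 2 + 2 * ‖y‖ ^ 2) * ‖z‖⁻¹ ^ 2 := by
          gcongr; nlinarith [sq_nonneg (‖z‖ - ‖y‖)]
      _ = 2 * (‖z‖⁻¹ * ‖z‖) ^ 2 + 2 * ‖y‖ ^ 2 * ‖z‖⁻¹ ^ 2 := by ring
      _ ≤ 2 * weight z + 2 * ‖y‖ ^ 2 * weight z := by
          rw [hzz]; gcongr; linarith
      _ ≤ 2 * (weight z * (1 + ‖y‖) ^ 2) := by nlinarith [mul_nonneg hy0 (weight_nonneg z)]
  calc _ ≤ ‖x‖ ^ 2 * (diracConst * (2 * |‖z‖⁻¹ - ‖x‖⁻¹| + ‖z‖⁻¹ ^ 2)) := by gcongr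
    _ = diracConst * (2 * (‖x‖ ^ 2 * |‖z‖⁻¹ - ‖x‖⁻¹|) + ‖x‖ ^ 2 * ‖z‖⁻¹ ^ 2) := by ring
    _ ≤ diracConst * (2 * (weight z * (1 + ‖y‖) ^ 2) + 2 * (weight z * (1 + ‖y‖) ^ 2)) := by
        gcongr
    _ = _ := by ring

variable {A : Space → SpinorOp} {N : ℝ}

/-- If the leading coefficient at infinity of a threshold state vanishes, the state decays like
`|x|⁻²`. -/
lemma norm_sq_mul_norm_conv_le (hA : IsWeightedSource A N) (hm : AEStronglyMeasurable A) (Φ : LInf)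
    (h0 : ((1 : SpinorOp) + beta) (∫ y, A y (Φ y)) = 0) {x : Space} (hx : x ≠ 0) :
    ‖x‖ ^ 2 * ‖conv (green 1) (fun y => A y (Φ y)) x‖ ≤
      4 * diracConst * (weightConst * (‖Φ‖ * N)) := by
  have hs := (IsSource.of_weighted hA hm).apply Φ
  have hw := IsSource.weighted_apply hA hm Φ
  set κ : ℂ := ((1 / (4 * Real.pi) : ℝ) : ℂ) * ((‖x‖⁻¹ : ℝ) : ℂ) with hκ
  have h1 : conv (green 1) (fun y => A y (Φ y)) x =
      ∫ y, (green 1 (x - y) + κ • ((1 : SpinorOp) + beta)) (A y (Φ y)) := by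
    simp only [add_apply (green 1 _)]
    rw [integral_add (isKernel_green_one.integrable_apply hs x)
      ((κ • ((1 : SpinorOp) + beta)).integrable_comp hs.integrable),
      ContinuousLinearMap.integral_comp_comm _ hs.integrable, smul_apply, h0,
      smul_zero, add_zero]
    rfl
  obtain ⟨hi, hi'⟩ := hw.integrable_weight_mul x
  have hD := one_le_diracConst
  have hn : ‖((‖x‖ ^ 2 : ℝ) : ℂ) • conv (green 1) (fun y => A y (Φ y)) x‖ =
      ‖x‖ ^ 2 * ‖conv (green 1) (fun y => A y (Φ y)) x‖ := by
    rw [norm_smul, Complex.norm_real, Real.norm_of_nonneg (by positivity)]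
  rw [← hn, h1, ← integral_smul]
  calc _ ≤ ∫ y, 4 * diracConst * (weight (x - y) * ‖(1 + ‖y‖) ^ 2 * ‖A y (Φ y)‖‖) := by
        refine norm_integral_le_of_norm_le (hi.const_mul _) ?_
        filter_upwards [ae_sub_ne_zero x] with y hy
        have h2 := norm_green_one_add_le hx hy
        rw [norm_smul, Complex.norm_real, Real.norm_of_nonneg (by positivity),
          Real.norm_of_nonneg (by positivity)]
        calc _ ≤ ‖x‖ ^ 2 * (‖green 1 (x - y) + κ • ((1 : SpinorOp) + beta)‖ * ‖A y (Φ y)‖) := by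
              gcongr; exact ContinuousLinearMap.le_opNorm _ _
          _ = ‖x‖ ^ 2 * ‖green 1 (x - y) + κ • ((1 : SpinorOp) + beta)‖ * ‖A y (Φ y)‖ := by ring
          _ ≤ 4 * diracConst * (weight (x - y) * (1 + ‖y‖) ^ 2) * ‖A y (Φ y)‖ := by gcongr
          _ = _ := by ring
    _ = 4 * diracConst * ∫ y, weight (x - y) * ‖(1 + ‖y‖) ^ 2 * ‖A y (Φ y)‖‖ :=
        integral_const_mul _ _
    _ ≤ _ := by gcongr

/-- Boundedness near the origin and decay `|x|⁻²` give `|Φ|² ≤ C² (1+|x|)⁻⁴`, which is integrable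
because `4 > 3`. -/
theorem memLp_two_of_leading_zero (hA : IsWeightedSource A N) (hm : AEStronglyMeasurable A)
    {Φ : LInf} (hΦ : ∀ᵐ x, Φ x = conv (green 1) (fun y => A y (Φ y)) x)
    (h0 : ((1 : SpinorOp) + beta) (∫ y, A y (Φ y)) = 0) : MemLp Φ 2 volume := by
  rw [memLp_two_iff_integrable_sq_norm (Lp.aestronglyMeasurable Φ)]
  set C := 2 * ‖Φ‖ + 2 * (4 * diracConst * (weightConst * (‖Φ‖ * N))) with hC
  have hint : Integrable (fun x : Space => C ^ 2 * (1 + ‖x‖) ^ (-(4 : ℝ))) :=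
    (integrable_one_add_norm (by simp; norm_num)).const_mul _
  refine hint.mono' ((Lp.aestronglyMeasurable Φ).norm.pow 2) ?_
  have hne : ∀ᵐ x : Space, x ≠ 0 := by rw [ae_iff]; simp
  filter_upwards [hΦ, hne, LInf.ae_norm_le Φ] with x hx hx0 hb
  have h1 := norm_sq_mul_norm_conv_le hA hm Φ h0 hx0
  rw [← hx] at h1
  have h2 : (1 + ‖x‖) ^ 2 * ‖Φ x‖ ≤ C := by
    have : (1 + ‖x‖) ^ 2 ≤ 2 + 2 * ‖x‖ ^ 2 := by nlinarith [sq_nonneg (1 - ‖x‖)]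
    have := mul_le_mul_of_nonneg_right this (norm_nonneg (Φ x))
    rw [hC]; linarith
  have hp : 0 < (1 + ‖x‖) ^ 2 := by positivity
  rw [Real.norm_of_nonneg (by positivity), Real.rpow_neg (by positivity)]
  have h4 : (1 + ‖x‖) ^ (4 : ℝ) = ((1 + ‖x‖) ^ 2) ^ 2 := by
    rw [← pow_mul]; exact_mod_cast Real.rpow_natCast (1 + ‖x‖) 4
  rw [h4, ← div_eq_mul_inv, le_div_iff₀ (by positivity), ← mul_pow]
  rw [mul_comm]
  gcongr

/-- In the resonance case the leading coefficient at infinity controls the state. -/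
theorem exists_leading_lower_bound {T₁ : LInf →L[ℂ] LInf} (hA : IsWeightedSource A N)
    (hm : AEStronglyMeasurable A)
    (hT : ∀ f : LInf, ∀ᵐ x, T₁ f x = conv (green 1) (fun y => A y (f y)) x)
    (hres : ResonanceCase A) :
    ∃ c : ℝ, 0 < c ∧ ∀ Φ : LInf, T₁ Φ = Φ →
      c * ‖Φ‖ ≤ ‖((1 : SpinorOp) + beta) (∫ y, A y (Φ y))‖ := by
  have hs := IsSource.of_weighted hA hm
  obtain ⟨ℓ, hℓ⟩ := exists_pairing hs.integrable
  set W := LinearMap.ker ((1 - T₁ : LInf →L[ℂ] LInf) : LInf →ₗ[ℂ] LInf) with hW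
  have hfix : ∀ v, v ∈ W ↔ T₁ v = v := fun v => by
    rw [hW, LinearMap.mem_ker]
    change v - T₁ v = 0 ↔ _
    rw [sub_eq_zero, eq_comm]
  have : FiniteDimensional ℂ W := finiteDimensional_fixed (isCompactOperator_threshold hs hT)
  let F : W →ₗ[ℂ] Spinor :=
    ((((1 : SpinorOp) + beta) ∘L ℓ : LInf →L[ℂ] Spinor) : LInf →ₗ[ℂ] Spinor) ∘ₗ W.subtype
  have hF : ∀ w : W, F w = ((1 : SpinorOp) + beta) (∫ y, A y ((w : LInf) y)) := fun w => by
    rw [← hℓ]; rfl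
  -- A nonzero state with vanishing leading coefficient would be square integrable. Injectivity on a
  -- finite-dimensional space then yields the uniform lower bound.
  have hker : LinearMap.ker F = ⊥ := by
    rw [LinearMap.ker_eq_bot']
    intro w hw
    by_contra hne
    rw [hF] at hw
    have hfw := (hfix _).1 w.2
    refine hres w ((mem_zeroSpace_iff hs hT _).2 hfw) (fun h => hne (Subtype.ext h))
      (memLp_two_of_leading_zero hA hm ?_ hw)
    have := hT w
    rwa [hfw] at this
  obtain ⟨K, hK, hanti⟩ := F.exists_antilipschitzWith hker
  have hK' : (0 : ℝ) < K := hK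
  refine ⟨(K : ℝ)⁻¹, by positivity, fun Φ hΦ => ?_⟩
  have h := hanti.le_mul_dist ⟨Φ, (hfix Φ).2 hΦ⟩ 0
  rw [map_zero, dist_zero_right, dist_zero_right, hF] at h
  rw [inv_mul_le_iff₀ hK']
  exact h

/-! ### Expansion of the perturbed form -/

/-- From `β² = 1` follows `(1+β)² = 2(1+β)`, so `(1+β)/2` is an orthogonal projection. -/
lemma inner_one_add_beta (w : Spinor) :
    (inner ℂ w (((1 : SpinorOp) + beta) w) : ℂ) =
      ((‖((1 : SpinorOp) + beta) w‖ ^ 2 / 2 : ℝ) : ℂ) := by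
  have hsa : IsSelfAdjoint ((1 : SpinorOp) + beta) :=
    IsSelfAdjoint.add (R := SpinorOp) (.one SpinorOp) beta_isSelfAdjoint
  have hsq : ((1 : SpinorOp) + beta) (((1 : SpinorOp) + beta) w) =
      (2 : ℂ) • ((1 : SpinorOp) + beta) w := by
    have h1 : beta (beta w) = w := DFunLike.congr_fun beta_mul_self w
    simp only [add_apply, one_apply_eq_self, map_add, h1]
    module
  have h2 : (inner ℂ (((1 : SpinorOp) + beta) w) (((1 : SpinorOp) + beta) w) : ℂ) =
      2 * inner ℂ w (((1 : SpinorOp) + beta) w) := by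
    rw [← inner_apply_of_isSelfAdjoint hsa, hsq, inner_smul_right]
  rw [inner_self_eq_norm_sq_to_K] at h2
  rw [Complex.ofReal_div, Complex.ofReal_pow, Complex.ofReal_ofNat, eq_div_iff two_ne_zero,
    mul_comm, ← h2]
  rfl

/-- The second-order kernel error grows like `|x-y| ≤ (1+|x|)(1+|y|)`. The factor in `y` is taken up
by the weight of `A`; the factor in `x` is left for the later integration against `AΦ`. -/
lemma norm_conv_green_expansion_le (hA : IsWeightedSource A N) (hm : AEStronglyMeasurable A)
    {κ : ℝ} (hκ : 0 ≤ κ) (hκ1 : κ ≤ 1) (Φ : LInf) (x : Space) :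
    ‖conv (fun z => green (Real.sqrt (κ ^ 2 + 1)) z - green 1 z) (fun y => A y (Φ y)) x
        + (((1 / (4 * Real.pi) : ℝ) : ℂ) * (Complex.I * (κ : ℂ))) •
          ((1 : SpinorOp) + beta) (∫ y, A y (Φ y))‖
      ≤ greenConst * κ ^ 2 * ((1 + weightConst) * (‖Φ‖ * N)) * (1 + ‖x‖) := by
  have hs := (IsSource.of_weighted hA hm).apply Φ
  have hw := IsSource.weighted_apply hA hm Φ
  have hK := isKernel_green_sub hκ hκ1
  set c : ℂ := ((1 / (4 * Real.pi) : ℝ) : ℂ) * (Complex.I * (κ : ℂ)) with hc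
  set E := Real.sqrt (κ ^ 2 + 1) with hE
  have h1 : conv (fun z => green E z - green 1 z) (fun y => A y (Φ y)) x
      + c • ((1 : SpinorOp) + beta) (∫ y, A y (Φ y)) =
      ∫ y, (green E (x - y) - green 1 (x - y) + c • ((1 : SpinorOp) + beta)) (A y (Φ y)) := by
    simp only [add_apply (green E _ - green 1 _)]
    rw [integral_add (hK.integrable_apply hs x)
      ((c • ((1 : SpinorOp) + beta)).integrable_comp hs.integrable),
      ContinuousLinearMap.integral_comp_comm _ hs.integrable, smul_apply]
    rfl
  set v : Space → ℝ := fun y => (1 + ‖y‖) ^ 2 * ‖A y (Φ y)‖ with hv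
  have hv0 : ∀ y, 0 ≤ v y := fun y => by positivity
  obtain ⟨hi, hi'⟩ := hw.integrable_weight_mul x
  have hint := hw.integrable.norm
  have hg := greenConst_pos
  rw [h1]
  calc _ ≤ ∫ y, greenConst * κ ^ 2 * ((1 + ‖x‖) * ‖v y‖ + weight (x - y) * ‖v y‖) := by
        refine norm_integral_le_of_norm_le (((hint.const_mul _).add hi).const_mul _) ?_
        filter_upwards [ae_sub_ne_zero x] with y hy
        refine (ContinuousLinearMap.le_opNorm _ _).trans ?_
        refine (mul_le_mul_of_nonneg_right (norm_green_expansion_le hκ hy) (norm_nonneg _)).trans ?_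
        rw [mul_assoc (greenConst * κ ^ 2), Real.norm_of_nonneg (hv0 y)]
        refine mul_le_mul_of_nonneg_left ?_ (by positivity)
        have ha := norm_nonneg (A y (Φ y))
        have hx := norm_nonneg x
        have hy' := norm_nonneg y
        have hle : ‖A y (Φ y)‖ ≤ v y := le_mul_of_one_le_left ha (by nlinarith)
        have hle2 : ‖x - y‖ * ‖A y (Φ y)‖ ≤ (1 + ‖x‖) * v y := by
          rw [hv]
          calc ‖x - y‖ * ‖A y (Φ y)‖ ≤ (‖x‖ + ‖y‖) * ‖A y (Φ y)‖ := by
                gcongr; exact norm_sub_le _ _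
            _ ≤ ((1 + ‖x‖) * (1 + ‖y‖) ^ 2) * ‖A y (Φ y)‖ := by
                gcongr; nlinarith [mul_nonneg hx hy', mul_nonneg hx (sq_nonneg ‖y‖)]
            _ = _ := by ring
        rw [add_mul]
        exact add_le_add hle2 (mul_le_mul_of_nonneg_left hle (weight_nonneg _))
    _ = greenConst * κ ^ 2 * ((1 + ‖x‖) * (∫ y, ‖v y‖) + ∫ y, weight (x - y) * ‖v y‖) := by
        rw [integral_const_mul, integral_add (hint.const_mul _) hi, integral_const_mul]
    _ ≤ greenConst * κ ^ 2 * ((1 + ‖x‖) * (‖Φ‖ * N) + weightConst * (‖Φ‖ * N)) := by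
        gcongr
        exact hw.integral_le
    _ ≤ greenConst * κ ^ 2 * ((1 + weightConst) * (‖Φ‖ * N) * (1 + ‖x‖)) := by
        refine mul_le_mul_of_nonneg_left ?_ (by positivity)
        have := mul_nonneg (mul_nonneg weightConst_pos.le hw.nonneg) (norm_nonneg x)
        nlinarith
    _ = _ := by ring

/-- To first order in the wave number, the form of `T^A_E - T^A_1` on a threshold state is the
square of its leading coefficient, up to an imaginary factor. -/
theorem norm_form_expansion_le (hA : IsWeightedSource A N) (hm : AEStronglyMeasurable A)
    (hsa : ∀ᵐ x, IsSelfAdjoint (A x)) {κ : ℝ} (hκ : 0 ≤ κ) (hκ1 : κ ≤ 1) {Φ g : LInf}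
    (hg : ∀ᵐ x, g x = conv (fun z => green (Real.sqrt (κ ^ 2 + 1)) z - green 1 z)
      (fun y => A y (Φ y)) x) :
    ‖form Φ A g + Complex.I * ((κ / (8 * Real.pi) *
        ‖((1 : SpinorOp) + beta) (∫ y, A y (Φ y))‖ ^ 2 : ℝ) : ℂ)‖
      ≤ greenConst * (1 + weightConst) * N ^ 2 * κ ^ 2 * ‖Φ‖ ^ 2 := by
  have hs := (IsSource.of_weighted hA hm).apply Φ
  have hw := IsSource.weighted_apply hA hm Φ
  have hK := isKernel_green_sub hκ hκ1
  set E := Real.sqrt (κ ^ 2 + 1) with hE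
  set u : Space → Spinor := fun y => A y (Φ y) with hu
  set c : ℂ := ((1 / (4 * Real.pi) : ℝ) : ℂ) * (Complex.I * (κ : ℂ)) with hc
  set q : Spinor := c • ((1 : SpinorOp) + beta) (∫ y, u y) with hq
  -- The first-order kernel is constant, so both integrals factor; `1/(4π)` becomes `1/(8π)` through
  -- `inner_one_add_beta`.
  have hconst : (∫ x, (inner ℂ (u x) q : ℂ)) = Complex.I * ((κ / (8 * Real.pi) *
        ‖((1 : SpinorOp) + beta) (∫ y, u y)‖ ^ 2 : ℝ) : ℂ) := by
    have h1 : (∫ x, (inner ℂ (u x) q : ℂ)) = inner ℂ (∫ x, u x) q := by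
      rw [← inner_conj_symm, ← integral_inner hs.integrable, ← integral_conj]
      refine integral_congr_ae (Filter.Eventually.of_forall fun x => ?_)
      exact (inner_conj_symm _ _).symm
    rw [h1, hq, inner_smul_right, inner_one_add_beta, hc]
    push_cast
    ring
  have hform : form Φ A g = ∫ x, (inner ℂ (u x)
      (conv (fun z => green E z - green 1 z) u x) : ℂ) := by
    rw [form_eq_integral_inner_left hsa]
    refine integral_congr_ae ?_
    filter_upwards [hg] with x hx
    rw [hx]
  have hi1 : Integrable fun x => (inner ℂ (u x)
      (conv (fun z => green E z - green 1 z) u x) : ℂ) := by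
    refine (hs.integrable.norm.mul_const _).mono' (hs.integrable.aestronglyMeasurable.inner
      (hK.aestronglyMeasurable_conv hs.integrable.aestronglyMeasurable))
      (Filter.Eventually.of_forall fun x => (norm_inner_le_norm _ _).trans
        (mul_le_mul_of_nonneg_left (hK.norm_conv_le hs x) (norm_nonneg _)))
  have hi2 : Integrable fun x => (inner ℂ (u x) q : ℂ) := hs.integrable.inner_const q
  rw [← hconst, hform, ← integral_add hi1 hi2]
  set v : Space → ℝ := fun y => (1 + ‖y‖) ^ 2 * ‖A y (Φ y)‖ with hv
  have hv0 : ∀ y, 0 ≤ v y := fun y => by positivity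
  have hgp := greenConst_pos
  have hwc := weightConst_pos
  have hN := hw.nonneg
  calc _ ≤ ∫ x, greenConst * κ ^ 2 * ((1 + weightConst) * (‖Φ‖ * N)) * ‖v x‖ := by
        refine norm_integral_le_of_norm_le (hw.integrable.norm.const_mul _)
          (Filter.Eventually.of_forall fun x => ?_)
        rw [← inner_add_right, Real.norm_of_nonneg (hv0 x)]
        refine (norm_inner_le_norm _ _).trans ?_
        refine (mul_le_mul_of_nonneg_left
          (norm_conv_green_expansion_le hA hm hκ hκ1 Φ x) (norm_nonneg _)).trans ?_
        rw [mul_comm, mul_assoc (greenConst * κ ^ 2 * _)]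
        refine mul_le_mul_of_nonneg_left ?_ (by positivity)
        refine mul_le_mul_of_nonneg_right ?_ (norm_nonneg _)
        nlinarith [norm_nonneg x]
    _ = greenConst * κ ^ 2 * ((1 + weightConst) * (‖Φ‖ * N)) * ∫ x, ‖v x‖ :=
        integral_const_mul _ _
    _ ≤ greenConst * κ ^ 2 * ((1 + weightConst) * (‖Φ‖ * N)) * (‖Φ‖ * N) := by
        gcongr
        exact hw.integral_le
    _ = _ := by ring

end

section

/-! ### The perturbed operator -/

variable {A B : Space → SpinorOp} {N b κ : ℝ}

/-- The first term is the threshold operator; the others are of order `κ`, `b` and `κ b` and make up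
the perturbation `S`. -/
lemma T_add_apply (hA : IsSource A N) (hB : IsSource B b) (hκ : 0 ≤ κ) (hκ1 : κ ≤ 1) (φ : LInf)
    (x : Space) :
    T (A + B) (Real.sqrt (κ ^ 2 + 1)) φ x =
      conv (green 1) (fun y => A y (φ y)) x
        + (conv (fun z => green (Real.sqrt (κ ^ 2 + 1)) z - green 1 z) (fun y => A y (φ y)) x
          + (conv (green 1) (fun y => B y (φ y)) x
            + conv (fun z => green (Real.sqrt (κ ^ 2 + 1)) z - green 1 z)
              (fun y => B y (φ y)) x)) := by
  have hK := isKernel_green hκ hκ1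
  rw [hK.conv_sub_kernel isKernel_green_one (hA.apply φ),
    hK.conv_sub_kernel isKernel_green_one (hB.apply φ)]
  have : T (A + B) (Real.sqrt (κ ^ 2 + 1)) φ x =
      conv (green (Real.sqrt (κ ^ 2 + 1))) (fun y => A y (φ y) + B y (φ y)) x := rfl
  rw [this, hK.conv_add (hA.apply φ) (hB.apply φ)]
  abel

lemma norm_planeWave (k : Space) (s : Spinor) (x : Space) : ‖planeWave k s x‖ = ‖s‖ := by
  rw [planeWave, norm_smul, Complex.norm_exp_I_mul_ofReal, one_mul]

lemma memLp_planeWave (k : Space) (s : Spinor) : MemLp (planeWave k s) ⊤ volume := by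
  refine memLp_top_of_bound (Continuous.aestronglyMeasurable ?_) ‖s‖
    (Filter.Eventually.of_forall fun x => (norm_planeWave k s x).le)
  unfold planeWave
  fun_prop

lemma norm_toLp_planeWave_le (k : Space) (s : Spinor) :
    ‖((memLp_planeWave k s).toLp _ : LInf)‖ ≤ ‖s‖ := by
  refine LInf.norm_le_of_ae_bound (norm_nonneg _) ?_
  filter_upwards [(memLp_planeWave k s).coeFn_toLp] with x hx
  rw [hx, norm_planeWave]

/-! ### The infimum of the perturbing form -/

lemma form_smul_smul (c : ℂ) (Φ : LInf) (B : Space → SpinorOp) :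
    ‖form (c • Φ : LInf) B (c • Φ : LInf)‖ = ‖c‖ ^ 2 * ‖form Φ B Φ‖ := by
  have : form (c • Φ : LInf) B (c • Φ : LInf) = ((starRingEnd ℂ) c * c) * form Φ B Φ := by
    unfold form
    rw [← integral_const_mul]
    refine integral_congr_ae ?_
    filter_upwards [Lp.coeFn_smul c Φ] with x hx
    rw [hx, Pi.smul_apply, map_smul, inner_smul_left, inner_smul_right, mul_assoc]
  rw [this, norm_mul, norm_mul, RCLike.norm_conj, sq]

lemma formInf_nonneg (A B : Space → SpinorOp) : 0 ≤ formInf A B := by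
  refine Real.sInf_nonneg ?_
  rintro r ⟨Ψ, -, -, rfl⟩
  exact norm_nonneg _

lemma bddBelow_formInf (A B : Space → SpinorOp) :
    BddBelow {r : ℝ | ∃ Ψ ∈ zeroSpace A, ‖Ψ‖ = 1 ∧ r = ‖form Ψ B Ψ‖} := by
  refine ⟨0, ?_⟩
  rintro r ⟨Ψ, -, -, rfl⟩
  exact norm_nonneg _

lemma exists_unit_multiple {Φ : LInf} (hΦ : Φ ≠ 0) :
    ∃ c : ℂ, ‖c‖ = ‖Φ‖⁻¹ ∧ ‖c • Φ‖ = 1 := by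
  refine ⟨((‖Φ‖⁻¹ : ℝ) : ℂ), by simp, ?_⟩
  rw [norm_smul, Complex.norm_real, norm_inv, norm_norm,
    inv_mul_cancel₀ (norm_pos_iff.2 hΦ).ne']

lemma formInf_mul_sq_le (hsmul : ∀ (c : ℂ) (Φ : LInf), Φ ∈ zeroSpace A → c • Φ ∈ zeroSpace A)
    {Φ : LInf} (hΦ : Φ ∈ zeroSpace A) :
    formInf A B * ‖Φ‖ ^ 2 ≤ ‖form Φ B Φ‖ := by
  by_cases h0 : Φ = 0
  · subst h0
    rw [norm_zero, zero_pow two_ne_zero, mul_zero]; exact norm_nonneg _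
  obtain ⟨c, hc, hc1⟩ := exists_unit_multiple h0
  have h := csInf_le (bddBelow_formInf A B) ⟨c • Φ, hsmul c Φ hΦ, hc1, rfl⟩
  rw [form_smul_smul, hc] at h
  have hp : 0 < ‖Φ‖ := norm_pos_iff.2 h0
  calc formInf A B * ‖Φ‖ ^ 2 ≤ ‖Φ‖⁻¹ ^ 2 * ‖form Φ B Φ‖ * ‖Φ‖ ^ 2 := by gcongr; exact h
    _ = ‖form Φ B Φ‖ := by field_simp

/-! ### The a priori estimate -/

/-- The lower bound for the reduced form on threshold states. -/
theorem reduced_form_lower_bound {c₁ t : ℝ} (hA : IsWeightedSource A N)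
    (hm : AEStronglyMeasurable A) (hsa : ∀ᵐ x, IsSelfAdjoint (A x)) (hB : IsSource B b)
    (hBsa : ∀ᵐ x, IsSelfAdjoint (B x)) (hκ : 0 ≤ κ) (hκ1 : κ ≤ 1) {Φ g₁ g₂ g₃ : LInf}
    (hΦ : ∀ᵐ x, Φ x = conv (green 1) (fun y => A y (Φ y)) x)
    (hc₁ : 0 ≤ c₁) (hlead : c₁ * ‖Φ‖ ≤ ‖((1 : SpinorOp) + beta) (∫ y, A y (Φ y))‖)
    (ht : t * ‖Φ‖ ^ 2 ≤ ‖form Φ B Φ‖)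
    (hg₁ : ∀ᵐ x, g₁ x = conv (fun z => green (Real.sqrt (κ ^ 2 + 1)) z - green 1 z)
      (fun y => A y (Φ y)) x)
    (hg₂ : ∀ᵐ x, g₂ x = conv (green 1) (fun y => B y (Φ y)) x)
    (hg₃ : ‖g₃‖ ≤ greenConst * κ * weightConst * b * ‖Φ‖) :
    (c₁ ^ 2 / (8 * Real.pi) * κ + t) / 2 * ‖Φ‖ ^ 2
      - greenConst * (1 + weightConst) * (N ^ 2 + N) * (κ ^ 2 + κ * b) * ‖Φ‖ ^ 2
      ≤ ‖form Φ A g₁ + (form Φ A g₂ + form Φ A g₃)‖ := by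
  have hs := IsSource.of_weighted hA hm
  have h1 := norm_form_expansion_le hA hm hsa hκ hκ1 hg₁
  have h2 := form_threshold hs hsa hB hΦ hg₂
  have hG := greenConst_pos
  have hW := weightConst_pos
  have hN := hs.nonneg
  have hb := hB.nonneg
  have h3 : ‖form Φ A g₃‖ ≤ greenConst * weightConst * N * (κ * b) * ‖Φ‖ ^ 2 := by
    calc ‖form Φ A g₃‖ ≤ N * ‖Φ‖ * ‖g₃‖ := norm_form_le hs _ _
      _ ≤ N * ‖Φ‖ * (greenConst * κ * weightConst * b * ‖Φ‖) := by gcongr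
      _ = _ := by ring
  set y : ℝ := κ / (8 * Real.pi) * ‖((1 : SpinorOp) + beta) (∫ y, A y (Φ y))‖ ^ 2 with hy
  have hy1 : c₁ ^ 2 / (8 * Real.pi) * κ * ‖Φ‖ ^ 2 ≤ y := by
    calc c₁ ^ 2 / (8 * Real.pi) * κ * ‖Φ‖ ^ 2 = κ / (8 * Real.pi) * (c₁ * ‖Φ‖) ^ 2 := by ring
      _ ≤ y := by rw [hy]; gcongr
  have hy0 : 0 ≤ y := by rw [hy]; positivity
  have him := form_self_im hBsa Φ
  set r : ℂ := form Φ B Φ with hr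
  -- As `r` is real, `‖w‖` dominates both `‖r‖` and `y`, hence their mean; this is the factor `1/2`
  -- in the bound.
  set w : ℂ := r - Complex.I * (y : ℂ) with hw
  have hre : w.re = r.re := by simp [hw]
  have himw : w.im = -y := by simp [hw, him]
  have hrn : ‖r‖ = |r.re| := by
    have : r = (r.re : ℂ) := Complex.ext (by simp) (by simp [him])
    conv_lhs => rw [this]
    rw [Complex.norm_real, Real.norm_eq_abs]
  have hw1 : ‖r‖ ≤ ‖w‖ := by rw [hrn, ← hre]; exact Complex.abs_re_le_norm w
  have hw2 : y ≤ ‖w‖ := by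
    have := Complex.abs_im_le_norm w
    rwa [himw, abs_neg, abs_of_nonneg hy0] at this
  have hdec : form Φ A g₁ + (form Φ A g₂ + form Φ A g₃) =
      w + ((form Φ A g₁ + Complex.I * (y : ℂ)) + form Φ A g₃) := by
    rw [h2, hw]; ring
  rw [hdec]
  have h4 := norm_sub_le_norm_add w ((form Φ A g₁ + Complex.I * (y : ℂ)) + form Φ A g₃)
  have h5 := norm_add_le (form Φ A g₁ + Complex.I * (y : ℂ)) (form Φ A g₃)
  have h6 : greenConst * (1 + weightConst) * N ^ 2 * κ ^ 2 * ‖Φ‖ ^ 2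
      + greenConst * weightConst * N * (κ * b) * ‖Φ‖ ^ 2
      ≤ greenConst * (1 + weightConst) * (N ^ 2 + N) * (κ ^ 2 + κ * b) * ‖Φ‖ ^ 2 := by
    have e1 : 0 ≤ greenConst * (1 + weightConst) * N * κ ^ 2 * ‖Φ‖ ^ 2 := by positivity
    have e2 : 0 ≤ greenConst * (1 + weightConst) * N ^ 2 * (κ * b) * ‖Φ‖ ^ 2 := by positivity
    have e3 : 0 ≤ greenConst * N * (κ * b) * ‖Φ‖ ^ 2 := by positivity
    nlinarith
  linarith

/-- Absorption of the error terms in the reduced equation. -/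
lemma absorb_errors {t F x S m N c s₀ σ η c₃ c₄ : ℝ} (hF : 0 ≤ F) (hx : 0 ≤ x)
    (hS : 0 ≤ S) (hN : 0 ≤ N) (hc : 0 < c) (hs₀ : 0 ≤ s₀) (ht : 0 < t)
    (hSσ : S ≤ s₀ * σ) (hσ1 : σ ≤ 1) (hσt : σ ^ 2 ≤ 2 * η * t)
    (hη : 2 * η * (c₃ + N * c * s₀ ^ 2) ≤ c₄)
    (hm : m ≤ c * (x + S * F))
    (hred : 2 * c₄ * t * F ^ 2 - 2 * η * c₃ * t * F ^ 2 ≤ N * F * (x + S * m)) :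
    c₄ * t * F ≤ N * (1 + s₀ * c) * x := by
  have h1 : S * m ≤ s₀ * c * x + 2 * η * c * s₀ ^ 2 * t * F := by
    have e1 : S * m ≤ S * (c * (x + S * F)) := mul_le_mul_of_nonneg_left hm hS
    have e2 : S * (c * x) ≤ s₀ * (c * x) := by
      refine mul_le_mul_of_nonneg_right (hSσ.trans ?_) (by positivity)
      exact mul_le_of_le_one_right hs₀ hσ1
    -- The feedback through the remainder is quadratic in `S`, hence a small multiple of `t`.
    -- Together with `c₃` it uses up half of the coercivity `2 * c₄`.
    have e3 : S ^ 2 ≤ s₀ ^ 2 * (2 * η * t) := by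
      calc S ^ 2 ≤ (s₀ * σ) ^ 2 := by gcongr
        _ = s₀ ^ 2 * σ ^ 2 := by ring
        _ ≤ _ := by gcongr
    have e4 := mul_le_mul_of_nonneg_right e3 (mul_nonneg hc.le hF)
    linarith
  have h2 := mul_le_mul_of_nonneg_left h1 (mul_nonneg hN hF)
  have h3 := mul_le_mul_of_nonneg_right hη (mul_nonneg ht.le (sq_nonneg F))
  have h4 : F * (c₄ * t * F) ≤ F * (N * (1 + s₀ * c) * x) := by linarith
  rcases hF.eq_or_lt with h | h
  · rw [← h, mul_zero]; positivity
  · exact le_of_mul_le_mul_left h4 h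

end

/-! ### The main estimate -/

variable {A : Space → SpinorOp}

lemma CriticalClass.continuous (hA : CriticalClass A) : Continuous A := by
  obtain ⟨L, hL⟩ := hA.lipschitz
  exact hL.continuous

lemma CriticalClass.exists_weightedSource (hA : CriticalClass A) : ∃ N, IsWeightedSource A N :=
  ⟨_, isSource_of_memLp hA.decay_one hA.decay_inf⟩

/-- The estimates for the fixed part and the remainder that follow from coercivity of the reduced
form. -/
theorem reduced_estimate {X : Type*} [NormedAddCommGroup X] [NormedSpace ℂ X] {T S : X →L[ℂ] X}
    {ℓ : X →L[ℂ] ℂ} {Φ φ χ : X} {N c s₀ c₃ c₄ η κ b t : ℝ} (hN : 0 ≤ N) (hc : 0 < c)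
    (hs₀ : 0 ≤ s₀) (hc₄ : 0 < c₄) (hχ : φ - T φ - S φ = χ) (hinv : ℓ (T φ) = ℓ φ)
    (hℓ : ∀ f, ‖ℓ f‖ ≤ N * ‖Φ‖ * ‖f‖)
    (hlow : 2 * c₄ * (κ + t) * ‖Φ‖ ^ 2 - 2 * η * c₃ * (κ + t) * ‖Φ‖ ^ 2 ≤ ‖ℓ (S Φ)‖)
    (hrem : ‖φ - Φ‖ ≤ c * (‖χ‖ + ‖S‖ * ‖Φ‖)) (hS : ‖S‖ ≤ s₀ * (κ + b)) (hσ : κ + b ≤ 1)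
    (hσt : (κ + b) ^ 2 ≤ 2 * η * (κ + t)) (hη : 2 * η * (c₃ + N * c * s₀ ^ 2) ≤ c₄)
    (hpos : 0 < κ + t) (htb : t ≤ b) :
    ‖Φ‖ ≤ N * (1 + s₀ * c) / c₄ * ‖χ‖ * (κ + t)⁻¹ ∧
      ‖φ - Φ‖ ≤ c * (1 + s₀ * (N * (1 + s₀ * c) / c₄)) * ‖χ‖ * (κ + b) * (κ + t)⁻¹ := by
  have hup : ‖ℓ (S Φ)‖ ≤ N * ‖Φ‖ * (‖χ‖ + ‖S‖ * ‖φ - Φ‖) := by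
    -- The functional annihilates `φ - T φ`, so the equation becomes `ℓ (S φ) = -ℓ χ`.
    have h1 : ℓ (S Φ) = -(ℓ (χ + S (φ - Φ))) := by
      rw [← hχ]
      simp only [map_add, map_sub, hinv]
      ring
    rw [h1, norm_neg]
    refine (hℓ _).trans (mul_le_mul_of_nonneg_left ?_ (by positivity))
    exact (norm_add_le _ _).trans (add_le_add_right (S.le_opNorm _) _)
  have hkey : c₄ * (κ + t) * ‖Φ‖ ≤ N * (1 + s₀ * c) * ‖χ‖ :=
    absorb_errors (norm_nonneg _) (norm_nonneg _) (norm_nonneg S) hN hc hs₀ hpos hS hσ hσt hη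
      hrem (hlow.trans hup)
  have hΦle : ‖Φ‖ ≤ N * (1 + s₀ * c) / c₄ * ‖χ‖ * (κ + t)⁻¹ := by
    rw [← div_eq_mul_inv, le_div_iff₀ hpos, div_mul_eq_mul_div, le_div_iff₀ hc₄]
    linarith
  refine ⟨hΦle, hrem.trans ?_⟩
  have hσ0 : 0 < κ + b := by linarith
  -- Since `t ≤ b`, the bare `‖χ‖` in the remainder can be given the same factor as the other term.
  have hone : 1 ≤ (κ + b) * (κ + t)⁻¹ := by
    rw [← div_eq_mul_inv, one_le_div hpos]; linarith
  have e1 : ‖S‖ * ‖Φ‖ ≤ s₀ * (κ + b) * (N * (1 + s₀ * c) / c₄ * ‖χ‖ * (κ + t)⁻¹) :=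
    mul_le_mul hS hΦle (norm_nonneg _) (by positivity)
  have e2 := mul_le_mul_of_nonneg_left hone (norm_nonneg χ)
  calc c * (‖χ‖ + ‖S‖ * ‖Φ‖)
      ≤ c * (‖χ‖ * ((κ + b) * (κ + t)⁻¹)
        + s₀ * (κ + b) * (N * (1 + s₀ * c) / c₄ * ‖χ‖ * (κ + t)⁻¹)) := by
        gcongr; linarith
    _ = _ := by ring

set_option maxHeartbeats 800000 in
/-- The Lippmann–Schwinger operator near the threshold, split into the threshold operator and a
small perturbation, with solvability and the estimates for its solutions. -/
theorem exists_threshold_estimate (hA : CriticalClass A) (hres : ResonanceCase A) :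
    ∃ (T₁ : LInf →L[ℂ] LInf) (M M' K k₀ : ℝ), 0 ≤ M ∧ 0 ≤ M' ∧ 0 < K ∧ 0 < k₀ ∧ k₀ ≤ 1 ∧
      (∀ Φ, Φ ∈ zeroSpace A ↔ T₁ Φ = Φ) ∧
      ∀ κ : ℝ, 0 ≤ κ → κ < k₀ → ∀ (B : Space → SpinorOp) (b t : ℝ), IsSource B b →
        (∀ᵐ x, IsSelfAdjoint (B x)) → b ≤ K → 0 ≤ t → t ≤ b → b ^ 2 ≤ K * t → 0 < κ + t →
        (∀ Φ ∈ zeroSpace A, t * ‖Φ‖ ^ 2 ≤ ‖form Φ B Φ‖) →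
        ∃ S : LInf →L[ℂ] LInf,
          (∀ φ : LInf, ∀ᵐ x, T (A + B) (Real.sqrt (κ ^ 2 + 1)) φ x = (T₁ φ + S φ : LInf) x) ∧
          (∀ χ, ∃ φ, φ - T₁ φ - S φ = χ) ∧
          (∀ φ, φ - T₁ φ - S φ = 0 → φ = 0) ∧
          ∀ φ, ∃ Φ, T₁ Φ = Φ ∧ ‖Φ‖ ≤ M * ‖φ - T₁ φ - S φ‖ * (κ + t)⁻¹ ∧
            ‖φ - Φ‖ ≤ M' * ‖φ - T₁ φ - S φ‖ * (κ + b) * (κ + t)⁻¹ := by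
  obtain ⟨N, hw⟩ := hA.exists_weightedSource
  have hm : AEStronglyMeasurable A := hA.continuous.aestronglyMeasurable
  have hsa : ∀ᵐ x : Space, IsSelfAdjoint (A x) := Filter.Eventually.of_forall hA.selfAdjoint
  have hs := IsSource.of_weighted hw hm
  have hN := hs.nonneg
  have hG := greenConst_pos
  have hW := weightConst_pos
  obtain ⟨T₁, hT, -⟩ := exists_kernelOp isKernel_green_one hs
  have hmem := mem_zeroSpace_iff hs hT
  have hfix : ∀ Φ : LInf, T₁ Φ = Φ → ∀ᵐ x, Φ x = conv (green 1) (fun y => A y (Φ y)) x :=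
    fun Φ hΦ => by
      have := hT Φ
      rwa [hΦ] at this
  choose a ha using exists_formFunctional hs
  obtain ⟨c, δ, hc, hδ, hred⟩ := exists_reduction (isCompactOperator_threshold hs hT) a
    (fun Φ Ψ h => by
      rw [ha] at h ⊢
      rw [← form_conj_symm hsa, h, map_zero])
    (fun Φ hΦ h => by
      have h1 : Φ ∈ zeroSpace A ∩ orthoSpace A :=
        ⟨(hmem Φ).2 hΦ, ((hmem Φ).2 hΦ).1, fun Ψ hΨ => by
          rw [← ha]; exact h Ψ ((hmem Ψ).1 hΨ)⟩
      rw [hA.transversal] at h1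
      exact h1)
    (fun Φ hΦ f => by
      rw [ha, ha]
      exact form_threshold hs hsa hs (hfix Φ hΦ) (hT f))
  obtain ⟨c₁, hc₁, hlead⟩ := exists_leading_lower_bound hw hm hT hres
  -- In `‖S‖ ≤ s₀ (κ + b)` the `N` comes from the energy shift acting on `A`, the `2` from the two
  -- terms containing `B`.
  obtain ⟨s₀, hs₀⟩ : ∃ r : ℝ, r = greenConst * weightConst * (N + 2) := ⟨_, rfl⟩
  have hs₀0 : 0 < s₀ := by rw [hs₀]; positivity
  obtain ⟨c₃, hc₃⟩ : ∃ r : ℝ, r = greenConst * (1 + weightConst) * (N ^ 2 + N) := ⟨_, rfl⟩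
  have hc₃0 : 0 ≤ c₃ := by rw [hc₃]; positivity
  obtain ⟨c₄, hc₄⟩ : ∃ r : ℝ, r = min (c₁ ^ 2 / (8 * Real.pi)) 1 / 4 := ⟨_, rfl⟩
  have hc₄0 : 0 < c₄ := by
    have := Real.pi_pos
    rw [hc₄]
    positivity
  -- `η` serves as both `K` and `k₀`. Its three bounds ensure `κ + b ≤ 1`, `‖S‖ ≤ δ`, and the
  -- absorption of the errors into `c₄`.
  obtain ⟨η, hη⟩ : ∃ r : ℝ, r = min (min (1 / 2) (δ / (2 * s₀)))
    (c₄ / (2 * (c₃ + N * c * s₀ ^ 2) + 1)) := ⟨_, rfl⟩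
  have hη0 : 0 < η := by rw [hη]; positivity
  have hη1 : η ≤ 1 / 2 := hη.le.trans ((min_le_left _ _).trans (min_le_left _ _))
  have hη2 : s₀ * (2 * η) ≤ δ := by
    have : η ≤ δ / (2 * s₀) := 
      hη.le.trans ((min_le_left _ _).trans (min_le_right _ _))
    rw [le_div_iff₀ (by positivity)] at this
    linarith
  have hη3 : 2 * η * (c₃ + N * c * s₀ ^ 2) ≤ c₄ := by
    have : η ≤ c₄ / (2 * (c₃ + N * c * s₀ ^ 2) + 1) := hη.le.trans (min_le_right _ _)
    rw [le_div_iff₀ (by positivity)] at this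
    linarith
  refine ⟨T₁, N * (1 + s₀ * c) / c₄, c * (1 + s₀ * (N * (1 + s₀ * c) / c₄)), η, η,
    by positivity, by positivity, hη0, hη0, by linarith, hmem, ?_⟩
  intro κ hκ hκη B b t hB hBsa hbη ht0 htb hbt htpos hform
  have hκ1 : κ ≤ 1 := by linarith
  have hb := hB.nonneg
  obtain ⟨S₁, hS₁, hS₁n⟩ := exists_kernelOp (isKernel_green_sub hκ hκ1) hs
  obtain ⟨S₂, hS₂, hS₂n⟩ := exists_kernelOp isKernel_green_one hB
  obtain ⟨S₃, hS₃, hS₃n⟩ := exists_kernelOp (isKernel_green_sub hκ hκ1) hB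
  obtain ⟨S, hS⟩ : ∃ S : LInf →L[ℂ] LInf, S = S₁ + (S₂ + S₃) := ⟨_, rfl⟩
  have hSapp : ∀ φ, S φ = S₁ φ + (S₂ φ + S₃ φ) := fun φ => by rw [hS]; rfl
  have hSn : ‖S‖ ≤ s₀ * (κ + b) := by
    have h1 := norm_add_le S₁ (S₂ + S₃)
    have h2 := norm_add_le S₂ S₃
    have h3 : greenConst * κ * weightConst * b ≤ greenConst * weightConst * b := by
      have := mul_le_mul_of_nonneg_left hκ1 (by positivity : 0 ≤ greenConst * weightConst * b)
      linarith
    have e1 : 0 ≤ greenConst * weightConst * κ := by positivity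
    have e2 : 0 ≤ greenConst * weightConst * N * b := by positivity
    rw [hS, hs₀]
    linarith
  have hσ : κ + b ≤ 2 * η := by linarith
  have hSδ : ‖S‖ ≤ δ :=
    hSn.trans ((mul_le_mul_of_nonneg_left hσ hs₀0.le).trans hη2)
  -- Here `(κ + b)² ≤ 2κ² + 2b²`, with `κ² ≤ ηκ` from `κ < k₀` and `b² ≤ ηt` from the perturbation
  -- class.
  have hσt : (κ + b) ^ 2 ≤ 2 * η * (κ + t) := by
    have e1 : κ ^ 2 ≤ η * κ := by
      rw [sq]; exact mul_le_mul_of_nonneg_right hκη.le hκ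
    linarith [sq_nonneg (κ - b)]
  have hkb : κ ^ 2 + κ * b ≤ 2 * η * (κ + t) := by
    have e1 : κ ^ 2 ≤ η * κ := by
      rw [sq]; exact mul_le_mul_of_nonneg_right hκη.le hκ
    have e2 : κ * b ≤ κ * η := mul_le_mul_of_nonneg_left hbη hκ
    have e3 : 0 ≤ η * t := by positivity
    linarith
  obtain ⟨hsurj, hsplit⟩ := hred S hSδ
  have hest : ∀ φ, ∃ Φ, T₁ Φ = Φ ∧ ‖Φ‖ ≤ N * (1 + s₀ * c) / c₄ * ‖φ - T₁ φ - S φ‖ * (κ + t)⁻¹ ∧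
      ‖φ - Φ‖ ≤ c * (1 + s₀ * (N * (1 + s₀ * c) / c₄)) * ‖φ - T₁ φ - S φ‖ * (κ + b) *
        (κ + t)⁻¹ := by
    intro φ
    obtain ⟨Φ, hΦ, hmle⟩ := hsplit φ
    refine ⟨Φ, hΦ, ?_⟩
    refine reduced_estimate (ℓ := a Φ) hN hc hs₀0.le hc₄0 rfl ?_
      (fun f => by rw [ha]; exact norm_form_le hs _ _) ?_ hmle hSn (by linarith) hσt hη3 htpos htb
    · rw [ha, ha]; exact form_threshold hs hsa hs (hfix Φ hΦ) (hT φ)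
    · have hlow := reduced_form_lower_bound hw hm hsa hB hBsa hκ hκ1 (hfix Φ hΦ) hc₁.le
        (hlead Φ hΦ) (hform Φ ((hmem Φ).2 hΦ)) (hS₁ Φ) (hS₂ Φ)
        (g₃ := S₃ Φ) (S₃.le_of_opNorm_le hS₃n Φ)
      rw [← ha, ← ha, ← ha, ← map_add, ← map_add, ← hSapp] at hlow
      refine le_trans ?_ hlow
      rw [← hc₃]
      have e1 : 2 * c₄ * (κ + t) ≤ (c₁ ^ 2 / (8 * Real.pi) * κ + t) / 2 := by
        have f1 : min (c₁ ^ 2 / (8 * Real.pi)) 1 * κ ≤ c₁ ^ 2 / (8 * Real.pi) * κ :=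
          mul_le_mul_of_nonneg_right (min_le_left _ _) hκ
        have f2 : min (c₁ ^ 2 / (8 * Real.pi)) 1 * t ≤ 1 * t :=
          mul_le_mul_of_nonneg_right (min_le_right _ _) ht0
        rw [hc₄]; linarith
      have e2 := mul_le_mul_of_nonneg_right e1 (sq_nonneg ‖Φ‖)
      have e3 := mul_le_mul_of_nonneg_right (mul_le_mul_of_nonneg_left hkb hc₃0)
        (sq_nonneg ‖Φ‖)
      linarith
  have hinj : ∀ φ, φ - T₁ φ - S φ = 0 → φ = 0 := by
    intro φ hφ
    obtain ⟨Φ, -, h1, h2⟩ := hest φ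
    rw [hφ, norm_zero] at h1 h2
    have h3 : Φ = 0 := norm_le_zero_iff.1 (h1.trans (by simp))
    have h4 : φ - Φ = 0 := norm_le_zero_iff.1 (h2.trans (by simp))
    rw [← sub_add_cancel φ Φ, h4, h3, add_zero]
  refine ⟨S, fun φ => ?_, hsurj hinj, hinj, hest⟩
  filter_upwards [hT φ, hS₁ φ, hS₂ φ, hS₃ φ, Lp.coeFn_add (T₁ φ) (S φ),
    Lp.coeFn_add (S₁ φ) (S₂ φ + S₃ φ), Lp.coeFn_add (S₂ φ) (S₃ φ)] with x h1 h2 h3 h4 h5 h6 h7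
  rw [T_add_apply hs hB hκ hκ1, h5, Pi.add_apply, hSapp, h6, Pi.add_apply, h7, Pi.add_apply, h1, h2,
    h3, h4]

end DiracCritical

end

/-! ### Generalized eigenfunctions near a threshold resonance. -/

theorem theorem3p5 (A : Space → SpinorOp) (hA : CriticalClass A) (hres : ResonanceCase A) :
    ∃ C K k₀ : ℝ, 0 < C ∧ 0 < K ∧ 0 < k₀ ∧
      ∀ k : Space, ‖k‖ < k₀ → ∀ s : Spinor, IsFreeSpinor k s →
        ∀ B : Space → SpinorOp, PerturbationClass A K B →
          (k ≠ 0 ∨ ¬ B =ᵐ[MeasureTheory.volume] 0) →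
            ∃ φ : LInf, IsGeneralizedEigenfunction (A + B) k s φ ∧
              (∀ φ' : LInf, IsGeneralizedEigenfunction (A + B) k s φ' → φ' = φ) ∧
              ∃ Φ ∈ zeroSpace A,
                ‖Φ‖ ≤ C * (formInf A B + ‖k‖)⁻¹ ∧
                ‖φ - Φ‖ < C * (‖k‖ + normOne B + normInf B) * (formInf A B + ‖k‖)⁻¹ := by
  obtain ⟨T₁, M, M', K, k₀, hM, hM', hK, hk₀, -, hmem, hmain⟩ := exists_threshold_estimate hA hres
  -- The `+ 1` makes the second estimate strict.
  refine ⟨M + M' + 1, K, k₀, by positivity, hK, hk₀, ?_⟩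
  intro k hk s hs B hB hne
  have hsrc := isSource_of_memLp hB.memLp_one hB.memLp_inf
  have hb0 := hsrc.nonneg
  have ht0 := formInf_nonneg A B
  have hsmul : ∀ (c : ℂ) (Φ : LInf), Φ ∈ zeroSpace A → c • Φ ∈ zeroSpace A := fun c Φ hΦ => by
    rw [hmem] at hΦ ⊢
    rw [map_smul, hΦ]
  -- Criticality provides a unit vector, so that `formInf` is not an infimum over the empty set.
  obtain ⟨Ψ₀, hΨ₀, hΨ₀ne⟩ := hA.critical
  obtain ⟨c, -, hunit⟩ := exists_unit_multiple hΨ₀ne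
  have hle : formInf A B ≤ normOne B + normInf B := by
    refine (csInf_le (bddBelow_formInf A B) ⟨c • Ψ₀, hsmul c Ψ₀ hΨ₀, hunit, rfl⟩).trans ?_
    have := norm_form_le hsrc (c • Ψ₀) (c • Ψ₀)
    rwa [hunit, mul_one, mul_one] at this
  have hsq : (normOne B + normInf B) ^ 2 ≤ K * formInf A B := by
    rw [← div_le_iff₀' hK]
    refine le_csInf ⟨_, c • Ψ₀, hsmul c Ψ₀ hΨ₀, hunit, rfl⟩ ?_
    rintro r ⟨Ψ, hΨ, hΨ1, rfl⟩
    rw [div_le_iff₀' hK]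
    have := hB.bound Ψ hΨ
    rwa [hΨ1, one_pow, one_mul] at this
  -- Smallness of `B` is not assumed: `b² ≤ K t` and `t ≤ b` force `b ≤ K`.
  have hbK : normOne B + normInf B ≤ K := by
    rcases hb0.eq_or_lt with h | h
    · rw [← h]; exact hK.le
    · refine le_of_mul_le_mul_right ?_ h
      rw [← sq]
      exact hsq.trans (mul_le_mul_of_nonneg_left hle hK.le)
  -- For `B ≠ 0` the inequality `b² ≤ K t` makes `t` positive, also when `k = 0`.
  have hpos : 0 < ‖k‖ + formInf A B := by
    rcases hne with h | h
    · have := norm_pos_iff.2 h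
      linarith
    · have hb : 0 < normOne B + normInf B := by
        refine hb0.lt_of_ne fun h0 => h ?_
        have h1 : 0 ≤ normOne B := ENNReal.toReal_nonneg
        have h2 : 0 ≤ normInf B := ENNReal.toReal_nonneg
        have h3 : (eLpNorm B 1 volume).toReal = 0 := by
          change normOne B = 0; linarith
        rw [ENNReal.toReal_eq_zero_iff, or_iff_left hB.memLp_one.2.ne] at h3
        exact (eLpNorm_eq_zero_iff hB.memLp_one.1 one_ne_zero).1 h3
      have := pos_of_mul_pos_right ((pow_pos hb 2).trans_le hsq) hK.le
      linarith [norm_nonneg k]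
  obtain ⟨S, hS, hsurj, hinj, hest⟩ := hmain ‖k‖ (norm_nonneg _) hk B _ (formInf A B) hsrc
    hB.selfAdjoint hbK ht0 hle hsq hpos fun Φ hΦ => formInf_mul_sq_le hsmul hΦ
  set χ : LInf := (memLp_planeWave k s).toLp _ with hχ
  have hχ1 : ‖χ‖ ≤ 1 := (norm_toLp_planeWave_le k s).trans hs.1.le
  have hiff : ∀ φ : LInf, IsGeneralizedEigenfunction (A + B) k s φ ↔ φ - T₁ φ - S φ = χ := by
    intro φ
    rw [sub_sub, sub_eq_iff_eq_add]
    constructor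
    · intro h
      refine Lp.ext ?_
      filter_upwards [h, hS φ, Lp.coeFn_add χ (T₁ φ + S φ), (memLp_planeWave k s).coeFn_toLp]
        with x h1 h2 h3 h4
      rw [h1, h3, Pi.add_apply, h4, ← h2]
      rfl
    · intro h
      have h0 : ∀ᵐ x, φ x = (χ + (T₁ φ + S φ) : LInf) x := by
        rw [← h]; exact Filter.Eventually.of_forall fun _ => rfl
      filter_upwards [h0, hS φ, Lp.coeFn_add χ (T₁ φ + S φ), (memLp_planeWave k s).coeFn_toLp]
        with x h1 h2 h3 h4
      rw [h1, h3, Pi.add_apply, h4, ← h2]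
      rfl
  obtain ⟨φ, hφ⟩ := hsurj χ
  refine ⟨φ, (hiff φ).2 hφ, fun φ' hφ' => ?_, ?_⟩
  · rw [hiff] at hφ'
    refine sub_eq_zero.1 (hinj _ ?_)
    rw [map_sub, map_sub]
    calc φ' - φ - (T₁ φ' - T₁ φ) - (S φ' - S φ)
        = (φ' - T₁ φ' - S φ') - (φ - T₁ φ - S φ) := by abel
      _ = 0 := by rw [hφ, hφ', sub_self]
  · obtain ⟨Φ, hΦ, h1, h2⟩ := hest φ
    rw [hφ] at h1 h2
    have hinv : 0 < (formInf A B + ‖k‖)⁻¹ := by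
      rw [add_comm]; positivity
    rw [add_comm ‖k‖ (formInf A B)] at h1 h2
    refine ⟨Φ, (hmem Φ).2 hΦ, h1.trans ?_, h2.trans_lt ?_⟩
    · refine mul_le_mul_of_nonneg_right ?_ hinv.le
      have := mul_le_of_le_one_right hM hχ1
      linarith
    · rw [add_assoc ‖k‖]
      refine mul_lt_mul_of_pos_right ?_ hinv
      have hσ : 0 < ‖k‖ + (normOne B + normInf B) := by linarith
      refine mul_lt_mul_of_pos_right ?_ hσ
      have := mul_le_of_le_one_right hM' hχ1
      linarith
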